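/- Let $X_1,X_2,\dots$ be real random variables on a probability space and $S_N=\sum_{n=1}^N X_n$. Assume that there are a complex Banach space $\mathbb{B}$, bounded linear operators $\mathcal{L}_t:\mathbb{B}\to\mathbb{B}$ $(t\in\mathbb{R})$, a vector $v\in\mathbb{B}$ and a bounded linear functional $\ell\in\mathbb{B}'$ such that $$\mathbb{E}\big(e^{itS_N}\big)=\ell(\mathcal{L}_t^N v)\qquad\text{for all } t\in\mathbb{R},\ N\ge 1,$$ and that the following hold. (A1) $t\mapsto\mathcal{L}_t$ is continuous in operator norm on $\mathbb{R}$, and for some integer $s\ge 4$ and some $\delta>0$ it is $s$ times continuously differentiable on $|t|\le\delta$. (A2) $1$ is an eigenvalue of $\mathcal{L}_0$ which is simple (of algebraic multiplicity one) and isolated in the spectrum, all other eigenvalues of $\mathcal{L}_0$ have absolute value less than $1$, and the essential spectrum $\{z:\ z-\mathcal{L}_0 \text{ is not Fredholm}\}$ is contained in $\{|z|<1\}$. (A3) For all $t\ne 0$, the spectrum of $\mathcal{L}_t$ is contained in $\{|z|<1\}$. (A4) There are positive real numbers $K,r_1,r_2,N_0$ such that $\|\mathcal{L}_t^N\|\le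 N^{-r_2}$ for all integers $N>N_0$ and all $t$ with $K\le|t|\le N^{r_1}$. Then there are $A\in\mathbb{R}$ and $\sigma^2\ge 0$ such that $\frac{S_N-NA}{\sqrt N}$ converges in distribution to the normal law $\mathcal{N}(0,\sigma^2)$ (the point mass at $0$ if $\sigma^2=0$); and if $\sigma^2>0$, then there is a polynomial $P_1$ with real coefficients such that $$\mathbb{P}\left(\frac{S_N-NA}{\sqrt N}\le z\right)=\mathfrak{N}(z)+\frac{P_1(z)}{N^{1/2}}\,\mathfrak{n}(z)+\mathcal{O}\left(\frac{1}{N^{\min\{1,\,1/2+r_1\}}}\right)\qquad (N\to\infty),$$ uniformly in $z\in\mathbb{R}$, where $\mathfrak{n}(y)=\frac{1}{\sqrt{2\pi\sigma^2}}e^{-y^2/(2\sigma^2)}$ and $\mathfrak{N}(z)=\int_{-\infty}^z\mathfrak{n}(y)\,dy$. -/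

import Mathlib

open MeasureTheory ProbabilityTheory Filter Topology
open scoped NNReal

namespace Edgeworth

section Operators

variable {B : Type*} [NormedAddCommGroup B] [NormedSpace ℂ B]

/-- The (Fredholm) essential spectrum of a bounded operator `T` on a complex Banach space: the set
of all `z` such that `z - T` is not a Fredholm operator. -/
def essentialSpectrum (T : B →L[ℂ] B) : Set ℂ :=
  {z : ℂ | ¬ (z • ContinuousLinearMap.id ℂ B - T).IsFredholm}

/-- (A1) with smoothness order `s`: the family is continuous in operator norm on the real line, and
it is `s` times continuously differentiable on some interval `[-δ, δ]` with `δ > 0`. -/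
def AssumptionA1 (L : ℝ → B →L[ℂ] B) (s : ℕ) : Prop :=
  Continuous L ∧ ∃ δ : ℝ, 0 < δ ∧ ContDiffOn ℝ s L (Set.Icc (-δ) δ)

/-- (A2), the spectral gap of `L 0`. -/
structure AssumptionA2 (L : ℝ → B →L[ℂ] B) : Prop where
  /-- `1` is an eigenvalue. -/
  eigenvalue : Module.End.HasEigenvalue (L 0 : Module.End ℂ B) 1
  /-- The eigenvalue `1` is simple: its algebraic multiplicity is one. -/
  simple : Module.finrank ℂ (Module.End.maxGenEigenspace (L 0 : Module.End ℂ B) 1) = 1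
  /-- The eigenvalue `1` is an isolated point of the spectrum. -/
  isolated : ∀ᶠ z in 𝓝[≠] (1 : ℂ), z ∉ spectrum ℂ (L 0)
  /-- All other eigenvalues have absolute value less than one. -/
  other_eigenvalues : ∀ z : ℂ, Module.End.HasEigenvalue (L 0 : Module.End ℂ B) z →
    z ≠ 1 → ‖z‖ < 1
  /-- The essential spectrum (a closed set) lies inside the open unit disk. -/
  essential : essentialSpectrum (L 0) ⊆ Metric.ball (0 : ℂ) 1

/-- (A3): for `t ≠ 0` the spectrum of `L t` lies in the open unit disk. -/
def AssumptionA3 (L : ℝ → B →L[ℂ] B) : Prop :=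
  ∀ t : ℝ, t ≠ 0 → spectrum ℂ (L t) ⊆ Metric.ball (0 : ℂ) 1

/-- (A4) with exponent `r₁`: there are `K, r₂, N₀ > 0` such that `‖(L t)^N‖ ≤ N^(-r₂)` whenever
`N > N₀` and `K ≤ |t| ≤ N^r₁`. -/
def AssumptionA4 (L : ℝ → B →L[ℂ] B) (r₁ : ℝ) : Prop :=
  0 < r₁ ∧ ∃ K r₂ N₀ : ℝ, 0 < K ∧ 0 < r₂ ∧ 0 < N₀ ∧
    ∀ (N : ℕ) (t : ℝ), N₀ < (N : ℝ) → K ≤ |t| → |t| ≤ (N : ℝ) ^ r₁ →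
      ‖(L t) ^ N‖ ≤ 1 / (N : ℝ) ^ r₂

end Operators

section Sums

variable {Ω : Type*}

/-- The partial sum `S_N = X_1 + ⋯ + X_N`. -/
def partialSum (X : ℕ → Ω → ℝ) (N : ℕ) (ω : Ω) : ℝ :=
  ∑ n ∈ Finset.Icc 1 N, X n ω

/-- The normalised sum `(S_N - N A) / √N`. -/
noncomputable def normalizedSum (X : ℕ → Ω → ℝ) (A : ℝ) (N : ℕ) (ω : Ω) : ℝ :=
  (partialSum X N ω - N * A) / √(N : ℝ)

/-- `(S_N - N A) / √N` converges in distribution to the centred normal law with variance `v`. -/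
def SatisfiesCLT [MeasurableSpace Ω] (P : Measure Ω) [IsProbabilityMeasure P]
    (X : ℕ → Ω → ℝ) (A : ℝ) (v : ℝ≥0) : Prop :=
  TendstoInDistribution (fun N : ℕ => normalizedSum X A N) atTop (id : ℝ → ℝ)
    (fun _ => P) (gaussianReal 0 v)

/-- The characteristic function of `S_N` is coded by the operators: for `N ≥ 1` and real `t`,
`E (exp (i t S_N)) = ℓ ((L t)^N u)`. -/
def CodedBy [MeasurableSpace Ω] (P : Measure Ω) (X : ℕ → Ω → ℝ)
    {B : Type*} [NormedAddCommGroup B] [NormedSpace ℂ B]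
    (L : ℝ → B →L[ℂ] B) (u : B) (ℓ : B →L[ℂ] ℂ) : Prop :=
  ∀ (N : ℕ) (t : ℝ), 1 ≤ N →
    ∫ ω, Complex.exp (Complex.I * (t : ℂ) * (partialSum X N ω : ℂ)) ∂P = ℓ (((L t) ^ N) u)

end Sums

/-- The density of the centred normal law with variance `v`. -/
noncomputable def normalDensity (v : ℝ≥0) (y : ℝ) : ℝ := gaussianPDFReal 0 v y

/-- The distribution function of the centred normal law with variance `v > 0`. -/
noncomputable def normalCDF (v : ℝ≥0) (z : ℝ) : ℝ := ∫ y in Set.Iic z, normalDensity v y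

end Edgeworth

/-! The proof is the Fourier method combined with perturbation of a spectral gap. Near `t = 0` the
simple eigenvalue `1` of `L 0` continues to an eigenvalue `lam t` with the smoothness of `L`, while
the rest of the operator keeps spectral radius below one. Hence the characteristic function of `S_N`
is `lam t ^ N * w t` plus an exponentially small remainder (`exists_eigen_splitting`,
`exists_smooth_splitting`, `exists_leading_expansion`). Smoothness comes from the implicit function
theorem, applied to the operator and to its transpose.

Expanding `log (lam t)` to third order and `w t` to first order gives the drift `A`, the variance
`v` and two real coefficients `k`, `a` (`exists_cumulant_expansion`). After centring and scaling by
`√N`, the characteristic function is close to `exp (-v t² / 2) * (1 + N^(-1/2) * (i a t + i k t³))`.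
Its leading factor alone gives the central limit theorem, degenerate case included. The whole
expression is the Fourier transform of a density whose primitive is the normal distribution function
plus a polynomial multiple of the normal density (`exists_edgeworth_density`).

The rate comes from Esseen's smoothing inequality (`exists_esseen_constant`) with cutoff `T` of
order `N ^ min 1 (1/2 + r₁)`. For `t ≤ c √N` the cumulant expansion leaves an integrable error of
size `1 / N` (`exists_central_estimate`). For larger `t` both transforms are small: the Edgeworth
one by Gaussian decay, the other by (A3) and compactness at bounded `t / √N` and by (A4) beyond,
where (A4) is applied to several blocks of iterates in order to reach `N⁻²`
(`exists_high_frequency_bound`). The truncation term `M / T` yields the stated exponent. As the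
smoothing inequality divides by `t`, every error has to carry a factor `t`; this is why the
remainder is also bounded by a multiple of `|t|`. -/

namespace Edgeworth

/-! ### Spectral gap, decay of powers, and smooth dependence of a simple eigenpair -/

section Spectral

variable {E : Type*} [NormedAddCommGroup E] [NormedSpace ℂ E] [CompleteSpace E]

/-- A bounded-below operator that is a norm limit of invertible operators is invertible. -/
theorem isUnit_of_bounded_below_of_approx {T : E →L[ℂ] E} {c : ℝ} (hc : 0 < c)
    (hT : ∀ x, c * ‖x‖ ≤ ‖T x‖) (happ : ∀ ε > 0, ∃ U : E →L[ℂ] E, IsUnit U ∧ ‖U - T‖ < ε) :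
    IsUnit T := by
  -- Within `c / 2` of `T`, the operator `U` is bounded below by `c / 2`, so `‖U⁻¹‖ ≤ 2 / c` and `T`
  -- lies in the Neumann ball around `U`.
  obtain ⟨_, ⟨U, rfl⟩, hU⟩ := happ (c / 2) (by positivity)
  have hinv : ‖(↑U⁻¹ : E →L[ℂ] E)‖ ≤ 2 / c := by
    refine ContinuousLinearMap.opNorm_le_bound _ (by positivity) fun y => ?_
    set x := (↑U⁻¹ : E →L[ℂ] E) y with hx
    have hy : (U : E →L[ℂ] E) x = y := by
      rw [hx, ← mul_apply_eq_comp, U.mul_inv, one_apply_eq_self]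
    have h1 : ‖((U : E →L[ℂ] E) - T) x‖ ≤ c / 2 * ‖x‖ :=
      (ContinuousLinearMap.le_opNorm _ _).trans (by gcongr)
    have h2 : ‖T x‖ ≤ ‖y‖ + ‖((U : E →L[ℂ] E) - T) x‖ := by
      have : T x = y - ((U : E →L[ℂ] E) - T) x := by simp [hy]
      rw [this]; exact norm_sub_le _ _
    have h3 := hT x
    rw [div_mul_eq_mul_div, le_div_iff₀ hc]
    nlinarith
  by_cases h0 : ‖(↑U⁻¹ : E →L[ℂ] E)‖ = 0
  · have h1 : (1 : E →L[ℂ] E) = 0 := by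
      rw [← U.mul_inv, norm_eq_zero.1 h0, mul_zero]
    have := subsingleton_of_zero_eq_one h1.symm
    exact isUnit_of_subsingleton _
  · have hpos : 0 < ‖(↑U⁻¹ : E →L[ℂ] E)‖ := lt_of_le_of_ne (norm_nonneg _) (Ne.symm h0)
    have : ‖T - U‖ < ‖(↑U⁻¹ : E →L[ℂ] E)‖⁻¹ := by
      rw [norm_sub_rev]
      refine hU.trans_le ?_
      rw [le_inv_comm₀ (by positivity) hpos]
      simpa using hinv
    exact ⟨Units.ofNearby U T this, rfl⟩

/-- Open mapping theorem: a Fredholm operator has closed range, so an injective one is an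
isomorphism onto its range. The `K + 1` covers the case `K = 0`. -/
theorem exists_bounded_below_of_isFredholm {T : E →L[ℂ] E} (hF : T.IsFredholm)
    (hinj : Function.Injective T) : ∃ c > 0, ∀ x, c * ‖x‖ ≤ ‖T x‖ := by
  obtain ⟨K, hK⟩ := T.antilipschitz_of_injective_of_isClosed_range hinj
    hF.isClosed_range
  refine ⟨1 / (K + 1), by positivity, fun x => ?_⟩
  have h := hK.le_mul_dist x 0
  simp only [dist_zero_right, map_zero] at h
  rw [div_mul_eq_mul_div, div_le_iff₀ (by positivity)]
  nlinarith [norm_nonneg (T x)]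

/-- A point off the essential spectrum that is neither an eigenvalue nor interior to the spectrum
lies in the resolvent set. -/
theorem notMem_spectrum_of_approx {T : E →L[ℂ] E} {z : ℂ} (hess : z ∉ essentialSpectrum T)
    (heig : ¬ Module.End.HasEigenvalue (T : Module.End ℂ E) z)
    (happ : ∀ ε > 0, ∃ w ∉ spectrum ℂ T, ‖w - z‖ < ε) : z ∉ spectrum ℂ T := by
  have hF : (z • ContinuousLinearMap.id ℂ E - T).IsFredholm := by
    simpa [essentialSpectrum] using hess
  have hinj : Function.Injective (z • ContinuousLinearMap.id ℂ E - T) := by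
    rw [injective_iff_map_eq_zero]
    intro x hx
    by_contra hne
    refine heig (Module.End.hasEigenvalue_of_hasEigenvector (x := x) ⟨?_, hne⟩)
    rw [Module.End.mem_eigenspace_iff]
    have hx' : z • x - T x = 0 := by simpa using hx
    exact (sub_eq_zero.1 hx').symm
  obtain ⟨c, hc, hb⟩ := exists_bounded_below_of_isFredholm hF hinj
  rw [spectrum.notMem_iff, Algebra.algebraMap_eq_smul_one]
  refine isUnit_of_bounded_below_of_approx hc hb fun ε hε => ?_
  obtain ⟨w, hw, hwz⟩ := happ (ε / (‖(1 : E →L[ℂ] E)‖ + 1)) (by positivity)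
  rw [spectrum.notMem_iff, Algebra.algebraMap_eq_smul_one] at hw
  refine ⟨_, hw, ?_⟩
  rw [sub_sub_sub_cancel_right, ← sub_smul]
  rw [lt_div_iff₀ (by positivity)] at hwz
  refine (norm_smul_le _ _).trans_lt (lt_of_le_of_lt ?_ hwz)
  gcongr
  linarith

/-- The spectral gap: the whole spectrum apart from `1` lies in the open unit disk. -/
theorem norm_lt_one_of_mem_spectrum {T : E →L[ℂ] E}
    (hess : essentialSpectrum T ⊆ Metric.ball (0 : ℂ) 1)
    (heig : ∀ z : ℂ, Module.End.HasEigenvalue (T : Module.End ℂ E) z → z ≠ 1 → ‖z‖ < 1)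
    {z : ℂ} (hz : 1 ≤ ‖z‖) (hz1 : z ≠ 1) : z ∉ spectrum ℂ T := by
  have key : ∀ z : ℂ, 1 ≤ ‖z‖ → z ≠ 1 → (∀ ε > 0, ∃ w ∉ spectrum ℂ T, ‖w - z‖ < ε) →
      z ∉ spectrum ℂ T := fun z hz hz1 h =>
    notMem_spectrum_of_approx (fun h => (mem_ball_zero_iff.1 (hess h)).not_ge hz)
      (fun h => (heig z h hz1).not_ge hz) h
  have hnonreal : ∀ z : ℂ, 1 ≤ ‖z‖ → z.im ≠ 0 → z ∉ spectrum ℂ T := by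
    intro z hz him hmem
    have hz0 : z ≠ 0 := by rintro rfl; simp at him
    -- The last spectral point on the ray through `z` is a limit of resolvent points further out,
    -- which contradicts `key`. Non-real `z` come first because their rays avoid `1`.
    let A : Set ℝ := Set.Ici 1 ∩ (fun r : ℝ => (r : ℂ) * z) ⁻¹' spectrum ℂ T
    have hA : IsClosed A := isClosed_Ici.inter ((spectrum.isClosed T).preimage (by fun_prop))
    have hAne : A.Nonempty := ⟨1, by simp, by simpa using hmem⟩
    have hAb : BddAbove A := by
      refine ⟨‖T‖ * ‖(1 : E →L[ℂ] E)‖, fun r hr => ?_⟩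
      have h1 : ‖(r : ℂ) * z‖ ≤ ‖T‖ * ‖(1 : E →L[ℂ] E)‖ :=
        spectrum.norm_le_norm_mul_of_mem hr.2
      have hr1 : (1 : ℝ) ≤ r := hr.1
      rw [norm_mul, Complex.norm_real, Real.norm_of_nonneg (by linarith)] at h1
      nlinarith
    have hs := hA.csSup_mem hAne hAb
    set r := sSup A
    have hr1 : (1 : ℝ) ≤ r := hs.1
    refine key (r * z) ?_ ?_ ?_ hs.2
    · rw [norm_mul, Complex.norm_real, Real.norm_of_nonneg (by linarith)]
      nlinarith
    · intro h
      have := congrArg Complex.im h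
      simp at this
      rcases this with h | h
      · linarith
      · exact him h
    · intro ε hε
      have hzpos : 0 < ‖z‖ := norm_pos_iff.2 hz0
      refine ⟨((r + ε / (2 * ‖z‖) : ℝ) : ℂ) * z, fun hmem' => ?_, ?_⟩
      · have : r + ε / (2 * ‖z‖) ≤ r := le_csSup hAb ⟨by
          have : 0 < ε / (2 * ‖z‖) := by positivity
          simp only [Set.mem_Ici]; linarith, hmem'⟩
        have : 0 < ε / (2 * ‖z‖) := by positivity
        linarith
      · rw [← sub_mul, norm_mul, ← Complex.ofReal_sub, Complex.norm_real, add_sub_cancel_left,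
          Real.norm_of_nonneg (by positivity), div_mul_eq_mul_div,
          div_lt_iff₀ (by positivity)]
        nlinarith
  -- A real `z` is approximated by `z + i ε / 2`, which is non-real and of no smaller modulus, hence
  -- already off the spectrum.
  refine key z hz hz1 fun ε hε => ?_
  by_cases him : z.im = 0
  · refine ⟨z + (ε / 2 : ℝ) * Complex.I, hnonreal _ ?_ ?_, ?_⟩
    · have h1 : |z.re| ≤ ‖z + (ε / 2 : ℝ) * Complex.I‖ := by
        simpa using Complex.abs_re_le_norm (z + (ε / 2 : ℝ) * Complex.I)
      have h2 : ‖z‖ = |z.re| := Complex.abs_re_eq_norm.2 him |>.symm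
      linarith
    · simp [him, hε.ne']
    · rw [add_sub_cancel_left, norm_mul, Complex.norm_I, Complex.norm_real,
        Real.norm_of_nonneg (by positivity)]
      linarith
  · exact ⟨z, hnonreal z hz him, by simpa using hε⟩

omit [CompleteSpace E] in
theorem rankOne_mul_self {e : E} {f : E →L[ℂ] ℂ} (hfe : f e = 1) :
    f.smulRight e * f.smulRight e = f.smulRight e := by
  ext x; simp [hfe]

/-- Peeling off the simple leading eigenvalue leaves an operator of spectral radius `< 1`. -/
theorem exists_eigen_splitting {T : E →L[ℂ] E}
    (h1 : Module.End.HasEigenvalue (T : Module.End ℂ E) 1)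
    (hsimple : Module.finrank ℂ (Module.End.maxGenEigenspace (T : Module.End ℂ E) 1) = 1)
    (hess : essentialSpectrum T ⊆ Metric.ball (0 : ℂ) 1)
    (heig : ∀ z : ℂ, Module.End.HasEigenvalue (T : Module.End ℂ E) z → z ≠ 1 → ‖z‖ < 1) :
    ∃ (e : E) (f : E →L[ℂ] ℂ), f e = 1 ∧ T e = e ∧ (∀ x, f (T x) = f x) ∧
      spectrum ℂ (T - f.smulRight e) ⊆ Metric.ball (0 : ℂ) 1 := by
  obtain ⟨e, he⟩ := h1.exists_hasEigenvector
  have hTe : T e = e := by simpa using he.apply_eq_smul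
  have he0 : e ≠ 0 := he.2
  set D : E →L[ℂ] E := (1 : ℂ) • ContinuousLinearMap.id ℂ E - T with hD
  have hDx : ∀ x, D x = x - T x := fun x => by simp [hD]
  have hF : D.IsFredholm := by
    by_contra h
    have := hess (show (1 : ℂ) ∈ essentialSpectrum T from h)
    simp at this
  have hmem : ∀ x (k : ℕ), (((T : Module.End ℂ E) - (1 : ℂ) • 1) ^ k) x = 0 →
      ∃ a : ℂ, x = a • e := by
    intro x k hx
    have hxm : x ∈ Module.End.maxGenEigenspace (T : Module.End ℂ E) 1 :=
      (Module.End.mem_maxGenEigenspace _ _ _).2 ⟨k, hx⟩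
    have hem : e ∈ Module.End.maxGenEigenspace (T : Module.End ℂ E) 1 :=
      Module.End.eigenspace_le_maxGenEigenspace he.1
    obtain ⟨a, ha⟩ := exists_smul_eq_of_finrank_eq_one hsimple
      (x := ⟨e, hem⟩) (by simpa [Subtype.ext_iff] using he0) ⟨x, hxm⟩
    exact ⟨a, by simpa [Subtype.ext_iff, eq_comm] using ha⟩
  have hker : ∀ x, T x = x → ∃ a : ℂ, x = a • e := fun x hx =>
    hmem x 1 (by simp [hx])
  -- No Jordan block: `D x = e` gives `(T - 1)² x = 0`, so `x` is a multiple of `e` and `D x = 0`.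
  have hnot : e ∉ D.range := by
    rintro ⟨x, hx⟩
    have hx' : x - T x = e := by simpa [hDx] using hx
    have hTx : T x = x - e := by rw [← hx']; abel
    obtain ⟨a, rfl⟩ := hmem x 2 (by simp [pow_two, hTx, hTe])
    simp [hTe] at hx'
    exact he0 hx'.symm
  -- The left eigenvector: `q` kills the range of `D` but not `e`; a Hahn–Banach functional norming
  -- `q e` is composed with `q` and rescaled.
  obtain ⟨f, hfe, hfD⟩ : ∃ f : E →L[ℂ] ℂ, f e = 1 ∧ ∀ x, f (D x) = 0 := by
    obtain ⟨p, hp⟩ := hF.closedComplemented_range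
    set q : E →L[ℂ] E := ContinuousLinearMap.id ℂ E - D.range.subtypeL ∘L p
    have hqe : q e ≠ 0 := by
      intro h
      have h' : e = p e := by simpa [q, sub_eq_zero] using h
      exact hnot (h' ▸ (p e).2)
    obtain ⟨g, -, hg⟩ := exists_dual_vector ℂ (q e) (norm_ne_zero_iff.2 hqe)
    have hn : (‖q e‖ : ℂ) ≠ 0 := by simpa using hqe
    refine ⟨(‖q e‖ : ℂ)⁻¹ • (g ∘L q), ?_, fun x => ?_⟩
    · simp [hg, hn]
    · have : q (D x) = 0 := by
        have := hp ⟨D x, ⟨x, rfl⟩⟩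
        simp [q, this]
      simp [this]
  have hfT : ∀ x, f (T x) = f x := fun x => by
    have := hfD x
    rw [hDx, map_sub, sub_eq_zero] at this
    exact this.symm
  refine ⟨e, f, hfe, hTe, hfT, ?_⟩
  have hres : ∀ z : ℂ, 1 ≤ ‖z‖ → z ≠ 1 → z ∉ spectrum ℂ (T - f.smulRight e) := by
    intro z hz hz1
    have hz0 : z ≠ 0 := by rintro rfl; simp at hz; linarith
    have hu := norm_lt_one_of_mem_spectrum hess heig hz hz1
    rw [spectrum.notMem_iff, Algebra.algebraMap_eq_smul_one] at hu ⊢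
    set P := f.smulRight e with hP
    have hPP : P * P = P := rankOne_mul_self hfe
    have hTP : T * P = P := by ext x; simp [hP, hTe]
    have hPT : P * T = P := by ext x; simp [hP, hfT]
    obtain ⟨U, hU⟩ := hu
    set R : E →L[ℂ] E := ↑U⁻¹
    have hUR : (z • (1 : E →L[ℂ] E) - T) * R = 1 := by rw [← hU]; exact U.mul_inv
    have hRU : R * (z • (1 : E →L[ℂ] E) - T) = 1 := by rw [← hU]; exact U.inv_mul
    have hPU : P * (z • (1 : E →L[ℂ] E) - T) = (z - 1) • P := by
      rw [mul_sub, mul_smul_comm, mul_one, hPT, sub_smul, one_smul]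
    have hUP : (z • (1 : E →L[ℂ] E) - T) * P = (z - 1) • P := by
      rw [sub_mul, smul_mul_assoc, one_mul, hTP, sub_smul, one_smul]
    have hPR : P = (z - 1) • (P * R) := by
      rw [← smul_mul_assoc, ← hPU, mul_assoc, hUR, mul_one]
    have hRP : P = (z - 1) • (R * P) := by
      rw [← mul_smul_comm, ← hUP, ← mul_assoc, hRU, one_mul]
    have hzz : z - 1 ≠ 0 := sub_ne_zero.2 hz1
    have hPR' : P * R = (z - 1)⁻¹ • P := by
      rw [eq_inv_smul_iff₀ hzz]; exact hPR.symm
    have hRP' : R * P = (z - 1)⁻¹ • P := by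
      rw [eq_inv_smul_iff₀ hzz]; exact hRP.symm
    have hreg : z • (1 : E →L[ℂ] E) - (T - P) = (z • (1 : E →L[ℂ] E) - T) + P := by abel
    have hscal : (z⁻¹ - (z - 1)⁻¹) * (z - 1) + (z⁻¹ - (z - 1)⁻¹) + (z - 1)⁻¹ = 0 := by
      field_simp; ring
    -- On the range of `P`, `T` acts as `1` and `T - P` as `0`; the correction to `R` replaces `(z -
    -- 1)⁻¹` by `z⁻¹` there.
    refine ⟨⟨z • (1 : E →L[ℂ] E) - (T - P), R + (z⁻¹ - (z - 1)⁻¹) • P, ?_, ?_⟩, rfl⟩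
    · rw [hreg, add_mul, mul_add, mul_add, hUR, mul_smul_comm, hUP, hPR', mul_smul_comm, hPP,
        smul_smul, add_assoc, ← add_smul, ← add_smul]
      rw [show (z⁻¹ - (z - 1)⁻¹) * (z - 1) + ((z - 1)⁻¹ + (z⁻¹ - (z - 1)⁻¹)) = 0 by
        rw [← hscal]; ring, zero_smul, add_zero]
    · rw [hreg, mul_add, add_mul, add_mul, hRU, smul_mul_assoc, hPU, hRP', smul_mul_assoc, hPP,
        smul_smul, add_assoc, ← add_smul, ← add_smul]
      rw [show (z⁻¹ - (z - 1)⁻¹) * (z - 1) + ((z - 1)⁻¹ + (z⁻¹ - (z - 1)⁻¹)) = 0 by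
        rw [← hscal]; ring, zero_smul, add_zero]
  intro z hz
  by_contra hz1
  simp only [Metric.mem_ball, dist_zero_right, not_lt] at hz1
  by_cases hz1' : z = 1
  swap
  · exact hres z hz1 hz1' hz
  subst hz1'
  refine absurd hz ?_
  rw [spectrum.notMem_iff, Algebra.algebraMap_eq_smul_one]
  -- At `z = 1`, `G = D + P` is bounded below and is a limit of the invertible operators `w - (T -
  -- P)` with real `w > 1`. This makes an index computation for `D` unnecessary.
  have : CompleteSpace D.range := hF.isClosed_range.completeSpace_coe
  obtain ⟨C, hC0, hC⟩ := D.rangeRestrict.exists_preimage_norm_le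
    D.toLinearMap.surjective_rangeRestrict
  set G : E →L[ℂ] E := (1 : ℂ) • (1 : E →L[ℂ] E) - (T - f.smulRight e) with hG
  have hGx : ∀ x, G x = D x + f x • e := fun x => by simp [hG, hDx, sub_add]
  have hfG : ∀ x, f (G x) = f x := fun x => by simp [hGx, hfD, hfe]
  set a := ‖f‖ * ‖e‖
  set b := (1 + a) * (C * (1 + a)) + a with hb
  have ha0 : 0 ≤ a := by positivity
  have hbound : ∀ x, ‖f x • e‖ ≤ a * ‖x‖ := fun x => by
    rw [norm_smul]
    calc ‖f x‖ * ‖e‖ ≤ ‖f‖ * ‖x‖ * ‖e‖ := by gcongr; exact f.le_opNorm x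
      _ = a * ‖x‖ := by ring
  refine isUnit_of_bounded_below_of_approx (c := 1 / (b + 1)) (by positivity) (fun x => ?_) ?_
  -- `x` and the short preimage `y` of `D x` differ by a multiple of `e` whose coefficient is read
  -- off by `f`; the component `f x` is controlled because `f ∘ G = f`.
  · obtain ⟨y, hy, hyn⟩ := hC ⟨D x, ⟨x, rfl⟩⟩
    have hy' : D y = D x := congrArg Subtype.val hy
    have hyn' : ‖y‖ ≤ C * ‖D x‖ := hyn
    obtain ⟨α, hα⟩ := hker (x - y) (by
      have : D (x - y) = 0 := by rw [map_sub, hy', sub_self]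
      rw [hDx, sub_eq_zero] at this
      exact this.symm)
    have hα' : α = f x - f y := by
      have := congrArg f hα
      simpa [hfe] using this.symm
    have hx : x = y - f y • e + f x • e := by
      rw [eq_add_of_sub_eq hα, hα', sub_smul]
      simp only [map_add, map_smul, map_sub, hfe, smul_eq_mul]
      module
    have h1 : ‖D x‖ ≤ (1 + a) * ‖G x‖ := by
      have : D x = G x - f (G x) • e := by rw [hfG, hGx]; abel
      rw [this]
      refine (norm_sub_le _ _).trans ?_
      have := hbound (G x)
      linarith
    have h2 : ‖f x • e‖ ≤ a * ‖G x‖ := by rw [← hfG]; exact hbound _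
    have h3 : ‖x‖ ≤ b * ‖G x‖ := by
      calc ‖x‖ ≤ ‖y - f y • e‖ + ‖f x • e‖ := by
            conv_lhs => rw [hx]
            exact norm_add_le _ _
        _ ≤ (‖y‖ + a * ‖y‖) + a * ‖G x‖ :=
            add_le_add ((norm_sub_le _ _).trans (add_le_add le_rfl (hbound y))) h2
        _ ≤ (1 + a) * (C * ((1 + a) * ‖G x‖)) + a * ‖G x‖ := by
            have : ‖y‖ ≤ C * ((1 + a) * ‖G x‖) := hyn'.trans (by gcongr)
            nlinarith
        _ = b * ‖G x‖ := by rw [hb]; ring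
    rw [div_mul_eq_mul_div, div_le_iff₀ (by positivity)]
    nlinarith [norm_nonneg (G x)]
  · intro ε hε
    set w : ℂ := ((1 + ε / (2 * (‖(1 : E →L[ℂ] E)‖ + 1)) : ℝ) : ℂ) with hw
    have hpos : 0 < ε / (2 * (‖(1 : E →L[ℂ] E)‖ + 1)) := by positivity
    have hwu := hres w (by
      rw [hw, Complex.norm_real, Real.norm_of_nonneg (by positivity)]; linarith) (by
      rw [hw]; norm_cast; linarith)
    rw [spectrum.notMem_iff, Algebra.algebraMap_eq_smul_one] at hwu
    refine ⟨_, hwu, ?_⟩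
    rw [hG, sub_sub_sub_cancel_right, ← sub_smul]
    refine (norm_smul_le _ _).trans_lt ?_
    rw [hw, ← Complex.ofReal_one, ← Complex.ofReal_sub, Complex.norm_real, add_sub_cancel_left,
      Real.norm_of_nonneg hpos.le, div_mul_eq_mul_div, div_lt_iff₀ (by positivity)]
    nlinarith [norm_nonneg (1 : E →L[ℂ] E)]

/-- Operators near one with spectrum in the open unit disk have uniformly decaying powers. -/
theorem eventually_norm_pow_le {T : E →L[ℂ] E} (hT : spectrum ℂ T ⊆ Metric.ball (0 : ℂ) 1) :
    ∃ C θ : ℝ, 0 < C ∧ 0 < θ ∧ θ < 1 ∧ ∀ᶠ U in 𝓝 T, ∀ N : ℕ, ‖U ^ N‖ ≤ C * θ ^ N := by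
  rcases subsingleton_or_nontrivial E with hE | hE
  · exact ⟨1, 1 / 2, one_pos, by norm_num, by norm_num, Eventually.of_forall fun U N => by
      rw [Subsingleton.elim (U ^ N) 0, norm_zero]; positivity⟩
  have hr : spectralRadius ℂ T < (1 : ℝ≥0) :=
    spectrum.spectralRadius_lt_of_forall_lt T fun z hz => by
      have := hT hz
      rw [mem_ball_zero_iff] at this
      exact_mod_cast this
  have hG := (spectrum.pow_nnnorm_pow_one_div_tendsto_nhds_spectralRadius T).eventually_lt_const hr
  obtain ⟨n, hn, hn0⟩ := (hG.and (eventually_gt_atTop 0)).exists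
  have hn1 : ‖T ^ n‖ < 1 := by
    by_contra h
    refine hn.not_ge ?_
    have h1 : (1 : ENNReal) ≤ (‖T ^ n‖₊ : ENNReal) := by
      have : (1 : ℝ≥0) ≤ ‖T ^ n‖₊ := by exact_mod_cast not_lt.1 h
      exact_mod_cast this
    simpa using ENNReal.rpow_le_rpow h1 (by positivity : (0 : ℝ) ≤ 1 / n)
  -- As `q` exceeds `‖T ^ n‖`, the bound `‖U ^ n‖ < q` persists near `T`. On dividing `N` by `n`,
  -- the factor `R ^ n` pays for the residual power and `1 / q` for rounding the exponent of `θ = q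
  -- ^ (1 / n)`.
  set q := (1 + ‖T ^ n‖) / 2 with hq
  have hq0 : 0 < q := by positivity
  have hq1 : q < 1 := by rw [hq]; linarith
  have hnn : (0 : ℝ) < n := by exact_mod_cast hn0
  set R := ‖T‖ + 1
  have hR : 1 ≤ R := by simp [R]
  have hθn : (q ^ (1 / n : ℝ)) ^ n = q := by
    rw [← Real.rpow_natCast, ← Real.rpow_mul hq0.le, one_div_mul_cancel hnn.ne', Real.rpow_one]
  have hθ0 : 0 < q ^ (1 / n : ℝ) := by positivity
  have hθ1 : q ^ (1 / n : ℝ) < 1 := Real.rpow_lt_one hq0.le hq1 (by positivity)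
  refine ⟨R ^ n / q, q ^ (1 / n : ℝ), by positivity, hθ0, hθ1, ?_⟩
  have hc1 : ∀ᶠ U in 𝓝 T, ‖U ^ n‖ < q :=
    ((continuous_pow n).norm.tendsto T).eventually_lt_const (by rw [hq]; linarith)
  have hc2 : ∀ᶠ U in 𝓝 T, ‖U‖ < R :=
    (continuous_norm.tendsto T).eventually_lt_const (by simp [R])
  filter_upwards [hc1, hc2] with U h1 h2 N
  set θ := q ^ (1 / n : ℝ)
  have hNdiv : U ^ N = (U ^ n) ^ (N / n) * U ^ (N % n) := by
    rw [← pow_mul, ← pow_add, Nat.div_add_mod]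
  have hmod : N % n < n := Nat.mod_lt _ hn0
  have hθmod : q ≤ θ ^ (N % n) := by
    conv_lhs => rw [← hθn]
    exact pow_le_pow_of_le_one hθ0.le hθ1.le hmod.le
  have hθN : θ ^ N = q ^ (N / n) * θ ^ (N % n) := by
    conv_rhs => rw [← hθn]
    rw [← pow_mul, ← pow_add, Nat.div_add_mod]
  calc ‖U ^ N‖ ≤ ‖U ^ n‖ ^ (N / n) * ‖U‖ ^ (N % n) := by
        rw [hNdiv]
        exact (norm_mul_le _ _).trans (mul_le_mul (norm_pow_le _ _) (norm_pow_le _ _)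
          (norm_nonneg _) (by positivity))
    _ ≤ q ^ (N / n) * R ^ n := by
        have : ‖U‖ ^ (N % n) ≤ R ^ n := (pow_le_pow_left₀ (norm_nonneg _) h2.le _).trans
          (pow_le_pow_right₀ hR hmod.le)
        gcongr
    _ ≤ R ^ n / q * θ ^ N := by
        rw [hθN, div_mul_eq_mul_div, le_div_iff₀ hq0]
        have : 0 ≤ q ^ (N / n) * R ^ n := by positivity
        nlinarith [mul_le_mul_of_nonneg_left hθmod this]

/-- Uniform exponential decay of powers along a compact set of parameters. -/
theorem exists_uniform_norm_pow_le {L : ℝ → E →L[ℂ] E} (hL : Continuous L) {K : Set ℝ}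
    (hK : IsCompact K) (hsp : ∀ t ∈ K, spectrum ℂ (L t) ⊆ Metric.ball (0 : ℂ) 1) :
    ∃ C θ : ℝ, 0 < C ∧ 0 < θ ∧ θ < 1 ∧ ∀ t ∈ K, ∀ N : ℕ, ‖L t ^ N‖ ≤ C * θ ^ N := by
  refine hK.induction_on (p := fun s => ∃ C θ : ℝ, 0 < C ∧ 0 < θ ∧ θ < 1 ∧
    ∀ t ∈ s, ∀ N : ℕ, ‖L t ^ N‖ ≤ C * θ ^ N) ⟨1, 1 / 2, by norm_num, by norm_num, by norm_num,
      by simp⟩ ?_ ?_ ?_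
  · rintro s t hst ⟨C, θ, h1, h2, h3, h4⟩
    exact ⟨C, θ, h1, h2, h3, fun x hx => h4 x (hst hx)⟩
  · rintro s t ⟨C, θ, h1, h2, h3, h4⟩ ⟨C', θ', h1', h2', h3', h4'⟩
    refine ⟨max C C', max θ θ', lt_max_of_lt_left h1, lt_max_of_lt_left h2, max_lt h3 h3', ?_⟩
    rintro x (hx | hx) N
    · refine (h4 x hx N).trans ?_
      gcongr
      · exact le_max_left _ _
      · exact le_max_left _ _
    · refine (h4' x hx N).trans ?_
      gcongr
      · exact le_max_right _ _
      · exact le_max_right _ _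
  · intro t ht
    obtain ⟨C, θ, h1, h2, h3, h4⟩ := eventually_norm_pow_le (hsp t ht)
    exact ⟨_, mem_nhdsWithin_of_mem_nhds (hL.continuousAt.eventually h4), C, θ, h1, h2, h3,
      fun x hx => hx⟩

/-- A simple eigenvalue isolated from the rest of the spectrum, together with its eigenvector,
depends smoothly on the operator. -/
theorem exists_smooth_eigenpair {T : E →L[ℂ] E} {e : E} {f : E →L[ℂ] ℂ} (hfe : f e = 1)
    (hTe : T e = e) (hfT : ∀ x, f (T x) = f x) {S : E →L[ℂ] E}
    (hS : ∀ x, S (x - T x) = x - f x • e) (hS' : ∀ x, S x - T (S x) = x - f x • e) :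
    ∃ (x : (E →L[ℂ] E) → E) (l : (E →L[ℂ] E) → ℂ), (∀ n : ℕ, ContDiffAt ℂ n x T) ∧
      (∀ n : ℕ, ContDiffAt ℂ n l T) ∧ x T = e ∧ l T = 1 ∧ ∀ᶠ A in 𝓝 T, A (x A) = l A • x A := by
  -- Implicit function theorem at `(T, (e, 1))`: the first component is the eigenvector equation,
  -- the second the normalisation by `f`.
  let F : (E →L[ℂ] E) × (E × ℂ) → E × ℂ := fun p => (p.1 p.2.1 - p.2.2 • p.2.1, f p.2.1)
  have hF : ContDiff ℂ ((⊤ : ℕ∞) : WithTop ℕ∞) F := by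
    refine ContDiff.prodMk (ContDiff.sub (ContDiff.clm_apply contDiff_fst contDiff_snd.fst)
      (ContDiff.smul contDiff_snd.snd contDiff_snd.fst)) (f.contDiff.comp contDiff_snd.fst)
  have hF' := (((hasFDerivAt_fst (𝕜 := ℂ) (p := (T, (e, (1 : ℂ))))).clm_apply
    (hasFDerivAt_snd (𝕜 := ℂ) (p := (T, (e, (1 : ℂ))))).fst).sub
    ((hasFDerivAt_snd (𝕜 := ℂ) (p := (T, (e, (1 : ℂ))))).snd.smul
      (hasFDerivAt_snd (𝕜 := ℂ) (p := (T, (e, (1 : ℂ))))).fst)).prodMk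
    (f.hasFDerivAt.comp (T, (e, (1 : ℂ))) (hasFDerivAt_snd (𝕜 := ℂ)).fst)
  have hfd : ∀ y : E × ℂ, (fderiv ℂ F (T, (e, (1 : ℂ))) ∘L .inr ℂ (E →L[ℂ] E) (E × ℂ)) y
      = (T y.1 - y.1 - y.2 • e, f y.1) := by
    intro y
    have : fderiv ℂ F (T, (e, (1 : ℂ))) = _ := hF'.fderiv
    rw [this]
    simp [sub_sub]
  -- `G` inverts the partial derivative `(y, μ) ↦ (T y - y - μ e, f y)`; here `S` inverts `1 - T` up
  -- to the projection `f (·) e`.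
  let G : E × ℂ →L[ℂ] E × ℂ := ContinuousLinearMap.prod
    ((ContinuousLinearMap.snd ℂ E ℂ).smulRight e - S ∘L (ContinuousLinearMap.id ℂ E - f.smulRight e)
      ∘L ContinuousLinearMap.fst ℂ E ℂ) (-(f ∘L ContinuousLinearMap.fst ℂ E ℂ))
  have hG : ∀ y, G y = (y.2 • e - S (y.1 - f y.1 • e), - f y.1) := fun y => by simp [G]
  have hinv : (fderiv ℂ F (T, (e, (1 : ℂ))) ∘L .inr ℂ (E →L[ℂ] E) (E × ℂ)).IsInvertible := by
    refine ⟨ContinuousLinearEquiv.equivOfInverse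
      (fderiv ℂ F (T, (e, (1 : ℂ))) ∘L .inr ℂ (E →L[ℂ] E) (E × ℂ)) G (fun y => ?_) (fun y => ?_), rfl⟩
    · rw [hfd, hG]
      have h1 : T y.1 - y.1 - y.2 • e - f (T y.1 - y.1 - y.2 • e) • e = -(y.1 - T y.1) := by
        simp only [map_sub, hfT, map_smul, hfe, smul_eq_mul]; module
      refine Prod.ext ?_ ?_
      · simp only [h1, map_neg, hS]; module
      · simp [hfT, hfe]
    · rw [hG, hfd]
      have h1 : ∀ w, f (S (w - f w • e)) = 0 := fun w => by
        rw [← hS', map_sub]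
        have h2 := hS (S w)
        have h3 := congrArg f (hS' (S w))
        simp only [map_sub, hfT, sub_self, map_smul, hfe, smul_eq_mul, mul_one] at h3
        have h4 := congrArg f h2
        simp only [map_sub, map_smul, hfe, smul_eq_mul, mul_one, sub_self] at h4
        rw [map_sub f]
        exact h4
      refine Prod.ext ?_ ?_
      · have h2 := hS' (y.1 - f y.1 • e)
        simp only [map_sub f, map_smul f, hfe, smul_eq_mul, mul_one, sub_self, zero_smul,
          sub_zero] at h2
        simp only [map_sub T, map_smul T, hTe]
        rw [← sub_eq_zero] at h2 ⊢
        rw [← h2]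
        module
      · simpa [hfe] using h1 y.1
  have hn : ((⊤ : ℕ∞) : WithTop ℕ∞) ≠ 0 := by simp
  have hFat : ContDiffAt ℂ ((⊤ : ℕ∞) : WithTop ℕ∞) F (T, (e, (1 : ℂ))) := hF.contDiffAt
  have hψ := hFat.contDiffAt_implicitFunction hn hinv
  have hψ0 := hFat.implicitFunction_apply_self hn hinv
  have hψe := hFat.eventually_apply_implicitFunction hn hinv
  set ψ := hFat.implicitFunction hn hinv
  refine ⟨fun A => (ψ A).1, fun A => (ψ A).2, fun n => ?_, fun n => ?_, ?_, ?_, ?_⟩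
  · exact (hψ.fst).of_le (by exact_mod_cast le_top)
  · exact (hψ.snd).of_le (by exact_mod_cast le_top)
  · exact congrArg Prod.fst hψ0
  · exact congrArg Prod.snd hψ0
  · filter_upwards [hψe] with A hA
    have := congrArg Prod.fst hA
    simpa [F, hTe, sub_eq_zero] using this

end Spectral

/-! ### Splitting of powers near the leading eigenvalue -/

section Perturbation

/-- The pieces `l • p` and `a - l • p` annihilate each other, so no cross terms appear. Exponents
start at one: at zero the identity would read `1 = p + 1`. -/
theorem pow_succ_eq_of_spectral_projection {R : Type*} [Ring R] [Algebra ℂ R] {a p : R} {l : ℂ}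
    (hp : p * p = p) (hap : a * p = l • p) (hpa : p * a = l • p) (N : ℕ) :
    a ^ (N + 1) = l ^ (N + 1) • p + (a - l • p) ^ (N + 1) := by
  have h0 : p * (a - l • p) = 0 := by rw [mul_sub, hpa, mul_smul_comm, hp, sub_self]
  induction N with
  | zero => simp
  | succ N ih =>
    rw [pow_succ' a, ih, mul_add, mul_smul_comm, hap, smul_smul, ← pow_succ]
    congr 1
    conv_lhs => rw [show a = (a - l • p) + l • p by abel]
    rw [add_mul, show a - l • p + l • p = a by abel, pow_succ' (a - l • p) (N + 1), smul_mul_assoc,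
      pow_succ' (a - l • p) N, ← mul_assoc p, h0, zero_mul, smul_zero, add_zero]

/-- Telescoping that keeps the order of factors, since `a` and `b` need not commute. -/
theorem pow_sub_pow_eq_sum {R : Type*} [Ring R] (a b : R) (N : ℕ) :
    a ^ N - b ^ N = ∑ i ∈ Finset.range N, a ^ i * (a - b) * b ^ (N - 1 - i) := by
  induction N with
  | zero => simp
  | succ N ih =>
    rw [Finset.sum_range_succ']
    have h : ∀ i ∈ Finset.range N, a ^ (i + 1) * (a - b) * b ^ (N + 1 - 1 - (i + 1))
        = a * (a ^ i * (a - b) * b ^ (N - 1 - i)) := by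
      intro i hi
      rw [show N + 1 - 1 - (i + 1) = N - 1 - i by omega, pow_succ']
      simp only [mul_assoc]
    rw [Finset.sum_congr rfl h, ← Finset.mul_sum, ← ih]
    simp only [pow_zero, one_mul, Nat.add_sub_cancel, Nat.sub_zero, pow_succ']
    noncomm_ring

/-- Each of the `N` telescoped terms carries only `N - 1` powers of `θ`, whence `1 / θ`. This turns
Lipschitz dependence on `t` into remainder bounds proportional to `|t|`. -/
theorem norm_pow_sub_pow_le {R : Type*} [NormedRing R] {a b : R} {C θ : ℝ}
    (hθ : 0 < θ) (ha : ∀ n, ‖a ^ n‖ ≤ C * θ ^ n) (hb : ∀ n, ‖b ^ n‖ ≤ C * θ ^ n) (N : ℕ) :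
    ‖a ^ N - b ^ N‖ ≤ C ^ 2 / θ * N * θ ^ N * ‖a - b‖ := by
  have hC : 0 ≤ C := by simpa using (norm_nonneg _).trans (ha 0)
  rw [pow_sub_pow_eq_sum]
  refine (norm_sum_le _ _).trans ?_
  calc ∑ i ∈ Finset.range N, ‖a ^ i * (a - b) * b ^ (N - 1 - i)‖
      ≤ ∑ i ∈ Finset.range N, C ^ 2 / θ * θ ^ N * ‖a - b‖ := by
        refine Finset.sum_le_sum fun i hi => ?_
        have hi' := Finset.mem_range.1 hi
        have hN : θ ^ N = θ ^ i * θ ^ (N - 1 - i) * θ := by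
          rw [← pow_add, ← pow_succ]; congr 1; omega
        calc ‖a ^ i * (a - b) * b ^ (N - 1 - i)‖
            ≤ ‖a ^ i‖ * ‖a - b‖ * ‖b ^ (N - 1 - i)‖ := norm_mul₃_le
          _ ≤ (C * θ ^ i) * ‖a - b‖ * (C * θ ^ (N - 1 - i)) := by
              gcongr
              · exact ha i
              · exact hb _
          _ = C ^ 2 / θ * θ ^ N * ‖a - b‖ := by rw [hN]; field_simp
    _ = C ^ 2 / θ * N * θ ^ N * ‖a - b‖ := by simp; ring

variable {B : Type*} [NormedAddCommGroup B] [NormedSpace ℂ B] [CompleteSpace B]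

/-- Near an operator with a simple leading eigenvalue `1` the powers split into a scalar leading
part and an exponentially small remainder, both depending smoothly on the operator. -/
theorem exists_smooth_splitting {T : B →L[ℂ] B} {e : B} {f : B →L[ℂ] ℂ} (hfe : f e = 1)
    (hTe : T e = e) (hfT : ∀ x, f (T x) = f x)
    (hsp : spectrum ℂ (T - f.smulRight e) ⊆ Metric.ball (0 : ℂ) 1) :
    ∃ (l : (B →L[ℂ] B) → ℂ) (p : (B →L[ℂ] B) → (B →L[ℂ] B)), (∀ n : ℕ, ContDiffAt ℂ n l T) ∧
      (∀ n : ℕ, ContDiffAt ℂ n p T) ∧ l T = 1 ∧ p T = f.smulRight e ∧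
      ∀ᶠ A in 𝓝 T, ∀ N : ℕ, A ^ (N + 1) = l A ^ (N + 1) • p A + (A - l A • p A) ^ (N + 1) := by
  have h1 : (1 : ℂ) ∉ spectrum ℂ (T - f.smulRight e) := fun h => by simpa using hsp h
  rw [spectrum.notMem_iff, Algebra.algebraMap_eq_smul_one, one_smul] at h1
  obtain ⟨U, hU⟩ := h1
  -- `S` is the inverse of `1 - T + f (·) e`; it fixes `e` and preserves `f`, hence inverts `1 - T`
  -- up to the projection.
  set S : B →L[ℂ] B := ↑U⁻¹
  have hUx : ∀ x, (U : B →L[ℂ] B) x = x - T x + f x • e := fun x => by simp [hU, sub_add]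
  have hSU : ∀ x, S ((U : B →L[ℂ] B) x) = x := fun x => by
    rw [← mul_apply_eq_comp, U.inv_mul, one_apply_eq_self]
  have hUS : ∀ x, (U : B →L[ℂ] B) (S x) = x := fun x => by
    rw [← mul_apply_eq_comp, U.mul_inv, one_apply_eq_self]
  have hSe : S e = e := by
    have := hSU e
    rwa [hUx, hTe, hfe, sub_self, zero_add, one_smul] at this
  have hfS : ∀ x, f (S x) = f x := fun x => by
    have := congrArg f (hUS x)
    rw [hUx] at this
    simpa [hfT, hfe] using this
  have hS : ∀ x, S (x - T x) = x - f x • e := fun x => by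
    rw [show x - T x = (U : B →L[ℂ] B) x - f x • e by rw [hUx]; abel, map_sub, hSU, map_smul, hSe]
  have hS' : ∀ x, S x - T (S x) = x - f x • e := fun x => by
    have := hUS x
    rw [hUx, hfS] at this
    exact eq_sub_of_add_eq this
  obtain ⟨x, l, hx, hl, hx0, hl0, hxl⟩ := exists_smooth_eigenpair hfe hTe hfT hS hS'
  -- Left eigenvectors are eigenvectors of the transpose on the dual space. Transposition reverses
  -- products, so `hS` and `hS'` exchange roles below.
  let adj : (B →L[ℂ] B) →L[ℂ] (B →L[ℂ] ℂ) →L[ℂ] (B →L[ℂ] ℂ) :=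
    (ContinuousLinearMap.compL ℂ B B ℂ).flip
  have hadj : ∀ A g y, adj A g y = g (A y) := fun A g y => rfl
  obtain ⟨y, m, hy, -, hy0, -, hym⟩ := exists_smooth_eigenpair (E := B →L[ℂ] ℂ) (T := adj T)
    (e := f) (f := ContinuousLinearMap.apply ℂ ℂ e) (S := adj S) (by simpa using hfe)
    (by ext z; simp [hadj, hfT]) (by intro g; simp [hadj, hTe])
    (by intro g; ext z
        have := congrArg g (hS' z)
        simpa [hadj, mul_comm] using this)
    (by intro g; ext z
        have := congrArg g (hS z)
        simpa [hadj, mul_comm] using this)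
  have hadjt : Tendsto adj (𝓝 T) (𝓝 (adj T)) := adj.continuous.tendsto T
  -- Division by this pairing of left and right eigenvectors makes the rank-one operator idempotent.
  let d : (B →L[ℂ] B) → ℂ := fun A => y (adj A) (x A)
  have hya : ∀ n : ℕ, ContDiffAt ℂ n (fun A => y (adj A)) T := fun n =>
    have hadjn : ContDiff ℂ n adj := by fun_prop
    (hy n).comp T hadjn.contDiffAt
  have hd : ∀ n : ℕ, ContDiffAt ℂ n d T := fun n => (hya n).clm_apply (hx n)
  have hd0 : d T = 1 := by simp [d, hx0, hy0, hfe]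
  have hdne : ∀ᶠ A in 𝓝 T, d A ≠ 0 :=
    (hd 0).continuousAt.eventually_ne (by rw [hd0]; exact one_ne_zero)
  refine ⟨l, fun A => (d A)⁻¹ • (y (adj A)).smulRight (x A), hl, fun n => ?_, hl0, ?_, ?_⟩
  · refine ((hd n).inv (by rw [hd0]; exact one_ne_zero)).smul ?_
    exact ((ContinuousLinearMap.smulRightL ℂ B B).contDiff.contDiffAt.comp T (hya n)).clm_apply
      (hx n)
  · simp only [hd0, inv_one, one_smul, hy0, hx0]
  · filter_upwards [hxl, hadjt.eventually hym, hdne] with A hA1 hA2 hA3 N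
    have hA2' : ∀ z, y (adj A) (A z) = m (adj A) * y (adj A) z := fun z => by
      have := congrArg (fun g : B →L[ℂ] ℂ => g z) hA2
      simpa [hadj] using this
    -- Pairing both eigenvector equations forces the left and right eigenvalues to agree when `d A ≠
    -- 0`.
    have hlm : l A = m (adj A) := by
      have h := hA2' (x A)
      rw [hA1, map_smul, smul_eq_mul] at h
      exact mul_right_cancel₀ hA3 h
    refine pow_succ_eq_of_spectral_projection ?_ ?_ ?_ N
    · ext z
      have : y (adj A) (x A) = d A := rfl
      simp only [mul_apply_eq_comp, smul_apply, ContinuousLinearMap.smulRight_apply, map_smul, this]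
      rw [inv_smul_smul₀ hA3]
    · ext z
      simp only [mul_apply_eq_comp, smul_apply,
        ContinuousLinearMap.smulRight_apply, map_smul, hA1]
      module
    · ext z
      simp only [mul_apply_eq_comp, smul_apply,
        ContinuousLinearMap.smulRight_apply, hA2', hlm]
      module

/-- The leading part and the exponentially small remainder of `ℓ ((L t) ^ N u)` near `t = 0`. -/
theorem exists_leading_expansion {L : ℝ → B →L[ℂ] B} {n : ℕ} (hn : 1 ≤ n)
    (hL : ContDiffAt ℝ n L 0) (hA2 : AssumptionA2 L) (u : B) (ℓ : B →L[ℂ] ℂ) :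
    ∃ (lam w : ℝ → ℂ) (r : ℕ → ℝ → ℂ) (C θ c : ℝ), ContDiffAt ℝ n lam 0 ∧ ContDiffAt ℝ n w 0 ∧
      lam 0 = 1 ∧ 0 < C ∧ 0 < θ ∧ θ < 1 ∧ 0 < c ∧ ∀ t : ℝ, |t| ≤ c → ∀ N : ℕ, 1 ≤ N →
        ℓ ((L t ^ N) u) = lam t ^ N * w t + r N t ∧ ‖r N t‖ ≤ C * θ ^ N ∧
        ‖r N t - r N 0‖ ≤ C * N * θ ^ N * |t| := by
  obtain ⟨e, f, hfe, hTe, hfT, hsp⟩ := exists_eigen_splitting hA2.eigenvalue hA2.simple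
    hA2.essential hA2.other_eigenvalues
  obtain ⟨l, p, hl, hp, hl0, hp0, hpow⟩ := exists_smooth_splitting hfe hTe hfT hsp
  obtain ⟨C, θ, hC, hθ, hθ1, hdecay⟩ := eventually_norm_pow_le hsp
  let Q : ℝ → B →L[ℂ] B := fun t => L t - l (L t) • p (L t)
  have hlL : ContDiffAt ℝ n (fun t => l (L t)) 0 := ((hl n).restrict_scalars ℝ).comp 0 hL
  have hpL : ContDiffAt ℝ n (fun t => p (L t)) 0 := ((hp n).restrict_scalars ℝ).comp 0 hL
  have hQ : ContDiffAt ℝ n Q 0 := hL.sub (hlL.smul hpL)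
  have hQ0 : Q 0 = L 0 - f.smulRight e := by simp [Q, hl0, hp0]
  obtain ⟨K, s, hs, hK⟩ := (hQ.of_le (by exact_mod_cast hn)).exists_lipschitzOnWith
  have hdec : ∀ᶠ t in 𝓝 (0 : ℝ), ∀ N : ℕ, ‖Q t ^ N‖ ≤ C * θ ^ N := by
    have h : Tendsto Q (𝓝 0) (𝓝 (L 0 - f.smulRight e)) := hQ0 ▸ hQ.continuousAt
    exact h.eventually hdecay
  have hpw := hL.continuousAt.eventually hpow
  obtain ⟨c, hc, hcs⟩ := Metric.nhds_basis_closedBall.eventually_iff.1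
    (hdec.and (hpw.and (eventually_mem_set.2 hs)))
  have hc0 : ∀ t : ℝ, |t| ≤ c → t ∈ Metric.closedBall (0 : ℝ) c := fun t ht => by simpa using ht
  set M := ‖ℓ‖ * ‖u‖
  have hM : 0 ≤ M := by positivity
  have hbd : ∀ A : B →L[ℂ] B, ‖ℓ (A u)‖ ≤ M * ‖A‖ := fun A =>
    (ℓ.le_opNorm _).trans (by
      have := A.le_opNorm u
      calc ‖ℓ‖ * ‖A u‖ ≤ ‖ℓ‖ * (‖A‖ * ‖u‖) := by gcongr
        _ = M * ‖A‖ := by simp only [M]; ring)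
  refine ⟨fun t => l (L t), fun t => ℓ (p (L t) u), fun N t => ℓ ((Q t ^ N) u),
    M * C + M * (C ^ 2 / θ * K) + 1, θ, c, hlL, ?_, hl0, by positivity, hθ, hθ1, hc, ?_⟩
  · exact (ℓ.restrictScalars ℝ).contDiff.contDiffAt.comp 0
      (((ContinuousLinearMap.apply ℂ B u).restrictScalars ℝ).contDiff.contDiffAt.comp 0 hpL)
  · intro t ht N hN
    obtain ⟨h1, h2, h3⟩ := hcs (hc0 t ht)
    obtain ⟨h1', -, h3'⟩ := hcs (hc0 0 (by simpa using hc.le))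
    refine ⟨?_, ?_, ?_⟩
    · obtain ⟨N, rfl⟩ := Nat.exists_eq_add_of_le' hN
      rw [h2 N]
      simp [Q]
    · refine (hbd _).trans ?_
      have : 0 ≤ M * (C ^ 2 / θ * K) + 1 := by positivity
      have h4 : 0 < θ ^ N := by positivity
      nlinarith [mul_le_mul_of_nonneg_left (h1 N) hM]
    · have h4 : ‖Q t - Q 0‖ ≤ K * |t| := by
        have := hK.dist_le_mul t h3 0 h3'
        simpa [dist_eq_norm] using this
      have h5 := norm_pow_sub_pow_le hθ h1 h1' N
      have : ℓ ((Q t ^ N) u) - ℓ ((Q 0 ^ N) u) = ℓ ((Q t ^ N - Q 0 ^ N) u) := by simp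
      rw [this]
      calc ‖ℓ ((Q t ^ N - Q 0 ^ N) u)‖ ≤ M * ‖Q t ^ N - Q 0 ^ N‖ := hbd _
        _ ≤ M * (C ^ 2 / θ * N * θ ^ N * (K * |t|)) := by gcongr; exact h5.trans (by gcongr)
        _ = M * (C ^ 2 / θ * K) * (N * θ ^ N * |t|) := by ring
        _ ≤ (M * C + M * (C ^ 2 / θ * K) + 1) * (N * θ ^ N * |t|) := by
            gcongr
            have : 0 ≤ M * C := by positivity
            linarith
        _ = _ := by ring

end Perturbation

/-! ### A nonnegative kernel and Esseen's smoothing inequality -/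

section Smoothing

/-- The Fejér-type kernel `(1 - cos y) / y ^ 2`, in its Fourier form. -/
noncomputable def fejer (y : ℝ) : ℝ := ∫ t in (0 : ℝ)..1, (1 - t) * Real.cos (t * y)

/-- An explicit antiderivative in `t`; the product form stays valid at `y = 0`. Nonnegativity and
quadratic decay of the kernel follow from it. -/
theorem fejer_mul_sq (y : ℝ) : fejer y * y ^ 2 = 1 - Real.cos y := by
  have h : ∀ t ∈ Set.uIcc (0 : ℝ) 1, HasDerivAt
      (fun t => (1 - t) * (y * Real.sin (t * y)) - Real.cos (t * y))
      ((1 - t) * Real.cos (t * y) * y ^ 2) t := by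
    intro t _
    have h1 : HasDerivAt (fun t : ℝ => t * y) y t := by simpa using (hasDerivAt_id t).mul_const y
    have h2 := ((hasDerivAt_id t).const_sub 1).mul ((h1.sin).const_mul y)
    exact (h2.sub h1.cos).congr_deriv (by simp only [id]; ring)
  rw [fejer, ← intervalIntegral.integral_mul_const,
    intervalIntegral.integral_eq_sub_of_hasDerivAt h (by
      apply Continuous.intervalIntegrable; fun_prop)]
  simp; ring

theorem continuous_fejer : Continuous fejer := by
  unfold fejer
  apply intervalIntegral.continuous_parametric_intervalIntegral_of_continuous'
  fun_prop

theorem fejer_zero : fejer 0 = 1 / 2 := by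
  have h : ∫ t in (0 : ℝ)..1, ((1 : ℝ) - t) = 1 / 2 := by
    rw [intervalIntegral.integral_sub (by simp) (by simp)]; norm_num
  simpa [fejer] using h

theorem fejer_nonneg (y : ℝ) : 0 ≤ fejer y := by
  by_cases hy : y = 0
  · rw [hy, fejer_zero]; norm_num
  · have h := fejer_mul_sq y
    have h2 : 0 < y ^ 2 := by positivity
    have h3 := Real.cos_le_one y
    by_contra hn
    nlinarith

theorem fejer_le (y : ℝ) : fejer y ≤ 3 * (1 + y ^ 2)⁻¹ := by
  have h1 : fejer y ≤ 1 := by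
    have h := intervalIntegral.norm_integral_le_of_norm_le_const (a := 0) (b := 1) (C := 1)
      (f := fun t => (1 - t) * Real.cos (t * y)) (by
        intro t ht
        rw [Set.uIoc_of_le zero_le_one] at ht
        rw [norm_mul, Real.norm_eq_abs, Real.norm_eq_abs, abs_of_nonneg (by linarith [ht.2])]
        have := Real.abs_cos_le_one (t * y)
        nlinarith [abs_nonneg (Real.cos (t * y)), ht.1, ht.2])
    have := le_abs_self (fejer y)
    rw [fejer] at this ⊢
    simp only [Real.norm_eq_abs] at h
    norm_num at h
    linarith
  have h2 := fejer_mul_sq y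
  have h3 := Real.neg_one_le_cos y
  rw [← div_eq_mul_inv, le_div_iff₀ (by positivity)]
  nlinarith

theorem integrable_fejer : Integrable fejer := by
  refine (integrable_inv_one_add_sq.const_mul 3).mono' continuous_fejer.aestronglyMeasurable
    (Eventually.of_forall fun y => ?_)
  rw [Real.norm_of_nonneg (fejer_nonneg y)]
  exact fejer_le y

theorem integral_fejer_pos : 0 < ∫ y, fejer y := by
  rw [integral_pos_iff_support_of_nonneg fejer_nonneg integrable_fejer]
  exact continuous_fejer.isOpen_support.measure_pos _ ⟨0, by simp [fejer_zero]⟩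

/-- With a quarter of the mass in the tail, the loss `2 η * (c / 4)` below is half of `η c` and can
be absorbed. -/
theorem exists_fejer_tail : ∃ h : ℝ, 0 < h ∧
    ∫ y in {y : ℝ | h < |y|}, fejer y ≤ (∫ y, fejer y) / 4 := by
  have ht := intervalIntegral_tendsto_integral integrable_fejer tendsto_neg_atTop_atBot tendsto_id
  have hc := integral_fejer_pos
  obtain ⟨h, h1, h2⟩ := ((ht.eventually_const_lt
    (show (3 / 4) * ∫ y, fejer y < ∫ y, fejer y by linarith)).and (eventually_gt_atTop 0)).exists
  refine ⟨h, h2, ?_⟩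
  simp only [id] at h1
  rw [intervalIntegral.integral_of_le (by linarith)] at h1
  have hs : MeasurableSet {y : ℝ | h < |y|} := measurableSet_lt measurable_const (by fun_prop)
  have hsub : {y : ℝ | h < |y|} ⊆ (Set.Ioc (-h) h ∪ {-h})ᶜ := by
    intro y hy
    simp only [Set.mem_ofPred_eq, lt_abs] at hy
    simp only [Set.mem_compl_iff, Set.mem_union, Set.mem_Ioc, Set.mem_singleton_iff, not_or,
      not_and_or, not_lt, not_le]
    rcases hy with hy | hy
    · exact ⟨Or.inr hy, by linarith⟩
    · exact ⟨Or.inl (by linarith), by linarith⟩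
  have hmono : ∫ y in {y : ℝ | h < |y|}, fejer y ≤ ∫ y in (Set.Ioc (-h) h)ᶜ, fejer y :=
    setIntegral_mono_set integrable_fejer.integrableOn
      (Eventually.of_forall fejer_nonneg)
      (Eventually.of_forall (hsub.trans (Set.compl_subset_compl.2 Set.subset_union_left)))
  have := integral_add_compl (measurableSet_Ioc (a := -h) (b := h)) integrable_fejer
  linarith

/-- Recovering the size of a bounded function of one-sided bounded decrease from its averages
against the kernel. -/
theorem abs_le_of_smoothed_abs_le {D : ℝ → ℝ} {η₀ m T S h : ℝ} (hD : ∀ x, |D x| ≤ η₀)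
    (hm : 0 ≤ m) (hlow : ∀ x y, x ≤ y → D x - m * (y - x) ≤ D y) (hT : 0 < T) (hh : 0 < h)
    (htail : ∫ y in {y : ℝ | h < |y|}, fejer y ≤ (∫ y, fejer y) / 4)
    (hint : ∀ x, Integrable fun y => D (x - y / T) * fejer y)
    (hS : ∀ x, |∫ y, D (x - y / T) * fejer y| ≤ S) (x : ℝ) :
    |D x| ≤ 2 * (S / (∫ y, fejer y) + 2 * m * h / T) := by
  set c := ∫ y, fejer y with hc
  have hc0 : 0 < c := integral_fejer_pos
  have hs : MeasurableSet {y : ℝ | h < |y|} := measurableSet_lt measurable_const (by fun_prop)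
  have hTh : 0 < h / T := by positivity
  -- A bound `η` improves to one containing only `η / 2`; taking `η` to be the supremum of `|D|`
  -- then absorbs this half.
  have step : ∀ η, (∀ x, |D x| ≤ η) → ∀ x, |D x| ≤ S / c + 2 * m * h / T + η / 2 := by
    intro η hη x
    have hη0 : 0 ≤ η := (abs_nonneg _).trans (hη x)
    have hcomp : ∀ a : ℝ, ∫ y, (a * fejer y - 2 * η * ({y : ℝ | h < |y|}.indicator fejer y))
        = a * c - 2 * η * ∫ y in {y : ℝ | h < |y|}, fejer y := by
      intro a
      rw [integral_sub (integrable_fejer.const_mul a)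
        ((integrable_fejer.indicator hs).const_mul _), integral_const_mul, integral_const_mul,
        integral_indicator hs]
    have hi : ∀ a : ℝ, Integrable fun y =>
        (a * fejer y - 2 * η * ({y : ℝ | h < |y|}.indicator fejer y)) := fun a =>
      (integrable_fejer.const_mul a).sub ((integrable_fejer.indicator hs).const_mul _)
    have hyT : ∀ y : ℝ, |y| ≤ h → |y / T| ≤ h / T := fun y hy => by
      rw [abs_div, abs_of_pos hT]; gcongr
    -- The centre is shifted by `h / T` so that `|y| ≤ h` samples `D` only to the right of `x`,
    -- within `2 h / T`, where `hlow` applies. On the tail the loss is at most `2 η`. The bound `dn`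
    -- shifts to the left.
    have up : (D x - 2 * m * h / T) * c - 2 * η * (c / 4) ≤ S := by
      refine le_trans ?_ ((le_abs_self _).trans (hS (x + h / T)))
      refine le_trans ?_ (integral_mono (hi (D x - 2 * m * h / T)) (hint (x + h / T)) ?_)
      · rw [hcomp]
        have := mul_le_mul_of_nonneg_left htail (by positivity : 0 ≤ 2 * η)
        linarith
      · intro y
        have hf := fejer_nonneg y
        by_cases hy : h < |y|
        · simp only [Set.indicator_of_mem (show y ∈ {y : ℝ | h < |y|} from hy)]
          have h1 := (abs_le.1 (hη (x + h / T - y / T))).1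
          have h2 := (abs_le.1 (hη x)).2
          have h3 : 0 ≤ 2 * m * h / T := by positivity
          nlinarith
        · simp only [Set.indicator_of_notMem (show y ∉ {y : ℝ | h < |y|} from hy), mul_zero,
            sub_zero]
          have h1 := abs_le.1 (hyT y (not_lt.1 hy))
          have h2 := hlow x (x + h / T - y / T) (by linarith)
          have h3 : m * (x + h / T - y / T - x) ≤ 2 * m * h / T := by
            calc m * (x + h / T - y / T - x) ≤ m * (2 * (h / T)) := by gcongr; linarith
              _ = 2 * m * h / T := by ring
          gcongr
          linarith
    have dn : (-D x - 2 * m * h / T) * c - 2 * η * (c / 4) ≤ S := by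
      refine le_trans ?_ ((neg_le_abs _).trans (hS (x - h / T)))
      rw [← integral_neg]
      refine le_trans ?_ (integral_mono (hi (-D x - 2 * m * h / T)) (hint (x - h / T)).neg ?_)
      · rw [hcomp]
        have := mul_le_mul_of_nonneg_left htail (by positivity : 0 ≤ 2 * η)
        linarith
      · intro y
        have hf := fejer_nonneg y
        simp only []
        rw [← neg_mul]
        by_cases hy : h < |y|
        · simp only [Set.indicator_of_mem (show y ∈ {y : ℝ | h < |y|} from hy)]
          have h1 := (abs_le.1 (hη (x - h / T - y / T))).2
          have h2 := (abs_le.1 (hη x)).1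
          have h3 : 0 ≤ 2 * m * h / T := by positivity
          nlinarith
        · simp only [Set.indicator_of_notMem (show y ∉ {y : ℝ | h < |y|} from hy), mul_zero,
            sub_zero]
          have h1 := abs_le.1 (hyT y (not_lt.1 hy))
          have h2 := hlow (x - h / T - y / T) x (by linarith)
          have h3 : m * (x - (x - h / T - y / T)) ≤ 2 * m * h / T := by
            calc m * (x - (x - h / T - y / T)) ≤ m * (2 * (h / T)) := by gcongr; linarith
              _ = 2 * m * h / T := by ring
          gcongr
          linarith
    have hSc : S / c * c = S := div_mul_cancel₀ _ hc0.ne'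
    rw [abs_le]
    constructor <;> by_contra! hcon <;> nlinarith
  have hbdd : BddAbove (Set.range fun x => |D x|) := ⟨η₀, by rintro _ ⟨x, rfl⟩; exact hD x⟩
  have h1 : ⨆ x, |D x| ≤ S / c + 2 * m * h / T + (⨆ x, |D x|) / 2 :=
    ciSup_le (step _ fun x => le_ciSup hbdd x)
  have h2 := le_ciSup hbdd x
  linarith


/-- The truncated primitive of the kernel in Fourier form. -/
theorem integral_fejer_interval (T a b x : ℝ) :
    ∫ y in (T * (a - x))..(T * (b - x)), fejer y = ∫ t in (0 : ℝ)..1, (1 - t) *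
      (Complex.exp ((t * T : ℝ) * x * Complex.I) *
        ∫ y in (T * a)..(T * b), Complex.exp (-(t * y : ℝ) * Complex.I)).re := by
  unfold fejer
  rw [intervalIntegral_intervalIntegral_swap]
  swap
  · refine IntegrableOn.mono_set ?_ (Set.prod_mono Set.uIoc_subset_uIcc Set.uIoc_subset_uIcc)
    refine ContinuousOn.integrableOn_compact (isCompact_uIcc.prod isCompact_uIcc) ?_
    simp only [Function.uncurry_def]
    fun_prop
  refine intervalIntegral.integral_congr fun t _ => ?_
  rw [intervalIntegral.integral_const_mul]
  congr 1
  rw [← intervalIntegral.integral_const_mul]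
  have h : ∀ y : ℝ, Real.cos (t * (y - T * x)) = RCLike.re (Complex.exp ((t * T : ℝ) * x * Complex.I)
      * Complex.exp (-(t * y : ℝ) * Complex.I)) := by
    intro y
    rw [RCLike.re_eq_complex_re, ← Complex.exp_add, ← Real.cos_neg, ← Complex.exp_ofReal_mul_I_re]
    congr 2
    push_cast; ring
  rw [← RCLike.re_eq_complex_re, ← intervalIntegral.intervalIntegral_re (by
    apply Continuous.intervalIntegrable; fun_prop)]
  simp_rw [← h]
  rw [intervalIntegral.integral_comp_sub_right (fun y => Real.cos (t * y)), mul_sub, mul_sub]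

/-- Uniformity in the endpoints is the point: it lets one endpoint go to infinity, and `1 / t`
cancels the factor `t` in the smoothing hypothesis. -/
theorem norm_integral_exp_le {t : ℝ} (ht : 0 < t) (a b : ℝ) :
    ‖∫ y in a..b, Complex.exp (-(t * y : ℝ) * Complex.I)‖ ≤ 2 / t := by
  have hc : -(t : ℂ) * Complex.I ≠ 0 := by simp [ht.ne']
  have h : ∀ y : ℝ, Complex.exp (-(t * y : ℝ) * Complex.I)
      = Complex.exp (-(t : ℂ) * Complex.I * y) := fun y => by congr 1; push_cast; ring
  simp_rw [h]
  rw [integral_exp_mul_complex hc, norm_div]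
  have h1 : ∀ y : ℝ, ‖Complex.exp (-(t : ℂ) * Complex.I * y)‖ = 1 := fun y => by
    rw [← h, ← Complex.ofReal_neg, Complex.norm_exp_ofReal_mul_I]
  have h2 : ‖-(t : ℂ) * Complex.I‖ = t := by simp [abs_of_pos ht]
  rw [h2]
  gcongr
  refine (norm_sub_le _ _).trans ?_
  rw [h1, h1]; norm_num

/-- Averages of a weighted distribution function against the kernel. -/
theorem integral_distribution_mul_fejer {μ : Measure ℝ} [SFinite μ] {w : ℝ → ℝ}
    (hw : Integrable w μ) {T : ℝ} (hT : 0 < T) (b : ℝ) :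
    (Integrable fun y => (∫ x in Set.Iic (b - y / T), w x ∂μ) * fejer y) ∧
    (Integrable (fun x => w x * ∫ y in Set.Iic (T * (b - x)), fejer y) μ) ∧
    ∫ y, (∫ x in Set.Iic (b - y / T), w x ∂μ) * fejer y =
      ∫ x, w x * (∫ y in Set.Iic (T * (b - x)), fejer y) ∂μ := by
  have hs : MeasurableSet {p : ℝ × ℝ | p.2 ≤ b - p.1 / T} :=
    measurableSet_le (by fun_prop) (by fun_prop)
  have hJ : Integrable ({p : ℝ × ℝ | p.2 ≤ b - p.1 / T}.indicator
      fun p => fejer p.1 * w p.2) (volume.prod μ) := (integrable_fejer.mul_prod hw).indicator hs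
  have h1 : ∀ y, ∫ x, {p : ℝ × ℝ | p.2 ≤ b - p.1 / T}.indicator
      (fun p => fejer p.1 * w p.2) (y, x) ∂μ = (∫ x in Set.Iic (b - y / T), w x ∂μ) * fejer y := by
    intro y
    rw [← integral_mul_const, ← integral_indicator measurableSet_Iic]
    refine integral_congr_ae (Eventually.of_forall fun x => ?_)
    simp only [Set.indicator, Set.mem_ofPred_eq, Set.mem_Iic]
    split_ifs <;> ring
  have h2 : ∀ x, ∫ y, {p : ℝ × ℝ | p.2 ≤ b - p.1 / T}.indicator
      (fun p => fejer p.1 * w p.2) (y, x) = w x * ∫ y in Set.Iic (T * (b - x)), fejer y := by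
    intro x
    rw [← integral_const_mul, ← integral_indicator measurableSet_Iic]
    refine integral_congr_ae (Eventually.of_forall fun y => ?_)
    have h : x ≤ b - y / T ↔ y ≤ T * (b - x) := by
      rw [le_sub_comm, div_le_iff₀ hT, mul_comm]
    simp only [Set.indicator, Set.mem_ofPred_eq, Set.mem_Iic, h]
    split_ifs <;> ring
  refine ⟨?_, ?_, ?_⟩
  · simpa only [h1] using hJ.integral_prod_left
  · simpa only [h2] using hJ.integral_prod_right
  · simp_rw [← h1, ← h2]
    exact integral_integral_swap hJ

/-- Increments of the averaged distribution function through the characteristic function. -/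
theorem integral_distribution_mul_fejer_sub {μ : Measure ℝ} [SFinite μ] {w : ℝ → ℝ}
    (hw : Integrable w μ) {T : ℝ} (hT : 0 < T) (a b : ℝ) :
    (IntervalIntegrable (fun t : ℝ => (1 - t) *
        ((∫ x, Complex.exp ((t * T : ℝ) * x * Complex.I) * w x ∂μ) *
        ∫ y in (T * a)..(T * b), Complex.exp (-(t * y : ℝ) * Complex.I)).re) volume 0 1) ∧
    (∫ y, (∫ x in Set.Iic (b - y / T), w x ∂μ) * fejer y) -
      ∫ y, (∫ x in Set.Iic (a - y / T), w x ∂μ) * fejer y =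
      ∫ t in (0 : ℝ)..1, (1 - t) *
        ((∫ x, Complex.exp ((t * T : ℝ) * x * Complex.I) * w x ∂μ) *
        ∫ y in (T * a)..(T * b), Complex.exp (-(t * y : ℝ) * Complex.I)).re := by
  set En : ℝ → ℂ := fun t => ∫ y in (T * a)..(T * b), Complex.exp (-(t * y : ℝ) * Complex.I)
    with hEn
  have hEc : Continuous En := by
    apply intervalIntegral.continuous_parametric_intervalIntegral_of_continuous'
    fun_prop
  have hEb : ∀ t, ‖En t‖ ≤ |T * b - T * a| := by
    intro t
    have := intervalIntegral.norm_integral_le_of_norm_le_const (a := T * a) (b := T * b) (C := 1)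
      (f := fun y : ℝ => Complex.exp (-(t * y : ℝ) * Complex.I)) (fun y _ => by
        rw [← Complex.ofReal_neg, Complex.norm_exp_ofReal_mul_I])
    simpa [hEn] using this
  -- The integrand for Fubini between frequency and position, dominated on `[0, 1]` by `|T b - T a|
  -- * |w x|`.
  let J : ℝ → ℝ → ℝ := fun t x =>
    w x * ((1 - t) * (Complex.exp ((t * T : ℝ) * x * Complex.I) * En t).re)
  have hJ : Integrable (Function.uncurry J) ((volume.restrict (Set.uIoc 0 1)).prod μ) := by
    have : IsFiniteMeasure (volume.restrict (Set.uIoc (0 : ℝ) 1)) := by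
      rw [Set.uIoc_of_le zero_le_one]; infer_instance
    have hb : Integrable (fun z : ℝ × ℝ => |T * b - T * a| * ‖w z.2‖)
        ((volume.restrict (Set.uIoc 0 1)).prod μ) :=
      Integrable.mul_prod (f := fun _ : ℝ => |T * b - T * a|) (integrable_const _) hw.norm
    have hc : Continuous fun z : ℝ × ℝ =>
        (1 - z.1) * (Complex.exp ((z.1 * T : ℝ) * z.2 * Complex.I) * En z.1).re := by fun_prop
    refine hb.mono' (hw.aestronglyMeasurable.comp_snd.mul hc.aestronglyMeasurable) ?_
    have hae : ∀ᵐ z ∂((volume.restrict (Set.uIoc (0 : ℝ) 1)).prod μ), z.1 ∈ Set.uIoc (0 : ℝ) 1 :=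
      Measure.quasiMeasurePreserving_fst.ae (ae_restrict_mem measurableSet_uIoc)
    filter_upwards [hae] with z hz
    rw [Set.uIoc_of_le zero_le_one] at hz
    have h1 : |(Complex.exp ((z.1 * T : ℝ) * z.2 * Complex.I) * En z.1).re|
        ≤ |T * b - T * a| := by
      refine (Complex.abs_re_le_norm _).trans ?_
      rw [norm_mul, ← Complex.ofReal_mul, Complex.norm_exp_ofReal_mul_I, one_mul]
      exact hEb _
    simp only [Function.uncurry, J, norm_mul, Real.norm_eq_abs]
    rw [abs_of_nonneg (by linarith [hz.2] : 0 ≤ 1 - z.1), mul_comm |T * b - T * a|]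
    gcongr
    have := abs_nonneg (Complex.exp ((z.1 * T : ℝ) * z.2 * Complex.I) * En z.1).re
    nlinarith [hz.1]
  have hJx : ∀ t : ℝ, ∫ x, J t x ∂μ = (1 - t) *
      ((∫ x, Complex.exp ((t * T : ℝ) * x * Complex.I) * w x ∂μ) * En t).re := by
    intro t
    have hi : Integrable (fun x : ℝ => Complex.exp ((t * T : ℝ) * x * Complex.I) * w x * En t) μ := by
      refine Integrable.mul_const ?_ _
      refine hw.ofReal.bdd_mul (c := 1) (Continuous.aestronglyMeasurable (by fun_prop)) ?_
      refine Eventually.of_forall fun x => ?_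
      rw [← Complex.ofReal_mul, Complex.norm_exp_ofReal_mul_I]
    rw [← integral_mul_const, ← RCLike.re_eq_complex_re, ← integral_re hi, ← integral_const_mul]
    refine integral_congr_ae (Eventually.of_forall fun x => ?_)
    have : Complex.exp ((t * T : ℝ) * x * Complex.I) * w x * En t
        = (w x : ℂ) * (Complex.exp ((t * T : ℝ) * x * Complex.I) * En t) := by ring
    simp only [J, this, RCLike.re_eq_complex_re, Complex.re_ofReal_mul]
    ring
  refine ⟨?_, ?_⟩
  · rw [intervalIntegrable_iff]
    have := hJ.integral_prod_left
    simp only [Function.uncurry, hJx] at this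
    exact this
  · have hcong : ∫ t in (0 : ℝ)..1, (1 - t) *
        ((∫ x, Complex.exp ((t * T : ℝ) * x * Complex.I) * w x ∂μ) * En t).re
        = ∫ t in (0 : ℝ)..1, ∫ x, J t x ∂μ := by simp_rw [hJx]
    rw [hcong, intervalIntegral_integral_swap hJ]
    obtain ⟨-, hb1, hb2⟩ := integral_distribution_mul_fejer hw hT b
    obtain ⟨-, ha1, ha2⟩ := integral_distribution_mul_fejer hw hT a
    rw [hb2, ha2, ← integral_sub hb1 ha1]
    refine integral_congr_ae (Eventually.of_forall fun x => ?_)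
    simp only []
    rw [← mul_sub, intervalIntegral.integral_Iic_sub_Iic integrable_fejer.integrableOn
      integrable_fejer.integrableOn, integral_fejer_interval, ← intervalIntegral.integral_const_mul]

/-- **Esseen's smoothing inequality**. -/
theorem exists_esseen_constant : ∃ C₀ : ℝ, 0 < C₀ ∧ ∀ (μ : Measure ℝ) [IsProbabilityMeasure μ]
    (g : ℝ → ℝ) (m T : ℝ) (b : ℝ → ℝ), Integrable g → (∀ x, |g x| ≤ m) → 0 < T →
    IntervalIntegrable b volume 0 T →
    (∀ t, 0 < t → t ≤ T → ‖charFun μ t - ∫ x : ℝ, Complex.exp (t * x * Complex.I) * g x‖ ≤ t * b t) →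
    ∀ z, |μ.real (Set.Iic z) - ∫ x in Set.Iic z, g x| ≤ C₀ * ((∫ t in (0 : ℝ)..T, b t) + m / T) := by
  obtain ⟨h, hh, htail⟩ := exists_fejer_tail
  set c := ∫ y, fejer y with hc
  have hc0 : 0 < c := integral_fejer_pos
  -- The two terms come from `2 * (2 I / c + 2 m h / T)`, where `I` is the integral of `b`.
  refine ⟨4 / c + 4 * h, by positivity, ?_⟩
  intro μ hμ g m T b hg hgm hT hb hφ z
  have hm : 0 ≤ m := (abs_nonneg _).trans (hgm 0)
  have hone : Integrable (fun _ : ℝ => (1 : ℝ)) μ := integrable_const _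
  set D : ℝ → ℝ := fun z => μ.real (Set.Iic z) - ∫ x in Set.Iic z, g x with hDdef
  have hD1 : ∀ z, D z = (∫ x in Set.Iic z, (1 : ℝ) ∂μ) - ∫ x in Set.Iic z, g x := fun z => by
    simp [hDdef]
  have hDb : ∀ x, |D x| ≤ 1 + ∫ x, |g x| := by
    intro x
    refine (abs_sub _ _).trans ?_
    gcongr
    · rw [abs_of_nonneg measureReal_nonneg]; exact measureReal_le_one
    · refine abs_integral_le_integral_abs.trans ?_
      exact setIntegral_le_integral hg.abs (Eventually.of_forall fun _ => abs_nonneg _)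
  have hlow : ∀ x y, x ≤ y → D x - m * (y - x) ≤ D y := by
    intro x y hxy
    have h1 : μ.real (Set.Iic x) ≤ μ.real (Set.Iic y) :=
      measureReal_mono (Set.Iic_subset_Iic.2 hxy)
    have h2 := intervalIntegral.integral_Iic_sub_Iic (hg.integrableOn (s := Set.Iic x))
      (hg.integrableOn (s := Set.Iic y))
    have h3 := intervalIntegral.norm_integral_le_of_norm_le_const (a := x) (b := y) (C := m)
      (f := g) (fun t _ => hgm t)
    rw [abs_of_nonneg (by linarith : 0 ≤ y - x), Real.norm_eq_abs] at h3
    have h4 := le_abs_self (∫ t in x..y, g t)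
    simp only [hDdef]
    linarith
  have hi : ∀ x, Integrable fun y => D (x - y / T) * fejer y := by
    intro x
    have h1 := (integral_distribution_mul_fejer hone hT x).1
    have h2 := (integral_distribution_mul_fejer hg hT x).1
    refine (h1.sub h2).congr (Eventually.of_forall fun y => ?_)
    simp only [hD1, Pi.sub_apply, sub_mul]
  have hDint : ∀ x, ∫ y, D (x - y / T) * fejer y =
      (∫ y, (∫ x in Set.Iic (x - y / T), (1 : ℝ) ∂μ) * fejer y) -
        ∫ y, (∫ x in Set.Iic (x - y / T), g x) * fejer y := by
    intro x
    rw [← integral_sub (integral_distribution_mul_fejer hone hT x).1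
      (integral_distribution_mul_fejer hg hT x).1]
    refine integral_congr_ae (Eventually.of_forall fun y => ?_)
    simp only [hD1, sub_mul]
  set I := ∫ t in (0 : ℝ)..T, b t with hI
  -- Comparing two centres keeps the inner exponential integral on a bounded interval. Its bound `2
  -- / t` removes the `t` in front of `b`, and `a → -∞` afterwards removes the second centre.
  have hdiff : ∀ x a, |(∫ y, D (x - y / T) * fejer y) - ∫ y, D (a - y / T) * fejer y| ≤ 2 * I := by
    intro x a
    obtain ⟨i1, e1⟩ := integral_distribution_mul_fejer_sub hone hT a x
    obtain ⟨i2, e2⟩ := integral_distribution_mul_fejer_sub hg hT a x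
    rw [hDint, hDint, sub_sub_sub_comm, e1, e2, ← intervalIntegral.integral_sub i1 i2]
    have hbT : IntervalIntegrable (fun t => 2 * T * b (t * T)) volume 0 1 := by
      refine IntervalIntegrable.const_mul ?_ _
      have := hb.comp_mul_right (c := T)
      simpa [hT.ne'] using this
    have hval : ∫ t in (0 : ℝ)..1, 2 * T * b (t * T) = 2 * I := by
      rw [intervalIntegral.integral_const_mul, intervalIntegral.integral_comp_mul_right _ hT.ne']
      simp only [zero_mul, one_mul, smul_eq_mul, hI]
      field_simp
    rw [← hval, ← Real.norm_eq_abs]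
    refine intervalIntegral.norm_integral_le_of_norm_le zero_le_one ?_ hbT
    refine Eventually.of_forall fun t ht => ?_
    rw [← mul_sub, ← Complex.sub_re, ← sub_mul, norm_mul, Real.norm_eq_abs, Real.norm_eq_abs,
      abs_of_nonneg (by linarith [ht.2])]
    have h1 := hφ (t * T) (by have := ht.1; positivity) (by nlinarith [ht.2])
    have hch : charFun μ (t * T) = ∫ x, Complex.exp ((t * T : ℝ) * x * Complex.I) * (1 : ℝ) ∂μ := by
      simp [charFun_apply_real]
    rw [hch] at h1
    have h2 := norm_integral_exp_le ht.1 (T * a) (T * x)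
    have ht0 := ht.1
    set Z := (∫ x, Complex.exp ((t * T : ℝ) * x * Complex.I) * (1 : ℝ) ∂μ) -
      ∫ x : ℝ, Complex.exp ((t * T : ℝ) * x * Complex.I) * g x
    set W := ∫ y in (T * a)..(T * x), Complex.exp (-(t * y : ℝ) * Complex.I)
    calc (1 - t) * |(Z * W).re| ≤ 1 * ‖Z * W‖ := by
          gcongr
          · linarith
          · exact Complex.abs_re_le_norm _
      _ ≤ (t * T * b (t * T)) * (2 / t) := by
          rw [one_mul, norm_mul]
          have := (norm_nonneg Z).trans h1
          gcongr
      _ = 2 * T * b (t * T) := by field_simp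
  have hlim : Tendsto (fun a => ∫ y, D (a - y / T) * fejer y) atBot (𝓝 0) := by
    have h0 : (0 : ℝ) = ∫ y, (0 : ℝ) * fejer y := by simp
    rw [h0]
    refine tendsto_integral_filter_of_dominated_convergence
      (fun y => (1 + ∫ x, |g x|) * fejer y) ?_ ?_ (integrable_fejer.const_mul _) ?_
    · exact Eventually.of_forall fun a => (hi a).aestronglyMeasurable
    · refine Eventually.of_forall fun a => Eventually.of_forall fun y => ?_
      rw [norm_mul, Real.norm_eq_abs, Real.norm_of_nonneg (fejer_nonneg y)]
      exact mul_le_mul_of_nonneg_right (hDb _) (fejer_nonneg y)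
    · refine Eventually.of_forall fun y => Tendsto.mul_const _ ?_
      have hat : Tendsto (fun a : ℝ => a - y / T) atBot atBot :=
        tendsto_atBot_add_const_right _ _ tendsto_id
      refine Tendsto.comp (g := D) (f := fun a : ℝ => a - y / T) ?_ hat
      have hw : ∀ {ν : Measure ℝ} {w : ℝ → ℝ}, Integrable w ν →
          Tendsto (fun z => ∫ x in Set.Iic z, w x ∂ν) atBot (𝓝 0) := by
        intro ν w hw
        have h0 : (0 : ℝ) = ∫ x, (0 : ℝ) ∂ν := by simp
        simp_rw [← integral_indicator measurableSet_Iic]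
        rw [h0]
        refine tendsto_integral_filter_of_dominated_convergence (fun x => ‖w x‖) ?_ ?_ hw.norm ?_
        · exact Eventually.of_forall fun a =>
            (hw.indicator measurableSet_Iic).aestronglyMeasurable
        · exact Eventually.of_forall fun a => Eventually.of_forall fun x =>
            norm_indicator_le_norm_self _ _
        · refine Eventually.of_forall fun x => tendsto_const_nhds.congr' ?_
          filter_upwards [eventually_lt_atBot x] with a ha
          rw [Set.indicator_of_notMem (by simpa using ha)]
      have := (hw hone).sub (hw hg)
      simp only [← hD1, sub_zero] at this
      exact this
  have hS : ∀ x, |∫ y, D (x - y / T) * fejer y| ≤ 2 * I := by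
    intro x
    have h1 := (hlim.const_sub (∫ y, D (x - y / T) * fejer y)).abs
    rw [sub_zero] at h1
    exact le_of_tendsto h1 (Eventually.of_forall fun a => hdiff x a)
  have key := abs_le_of_smoothed_abs_le hDb hm hlow hT hh htail hi hS z
  have hI0 : 0 ≤ I := by
    have := (abs_nonneg _).trans (hS 0)
    linarith
  have hmT : 0 ≤ m / T := by positivity
  have h1 : 2 * (2 * I / c + 2 * m * h / T) = 4 / c * I + 4 * h * (m / T) := by ring
  have h2 : 0 ≤ 4 / c * (m / T) := by positivity
  have h3 : 0 ≤ 4 * h * I := by positivity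
  rw [← hc, h1] at key
  refine key.trans ?_
  linarith

end Smoothing

/-! ### Polynomial multiples of the Gaussian density and their Fourier transforms -/

section GaussianPolynomial

variable {v : ℝ≥0}

/-- The polynomial `q` with `(p 𝔫)' = q 𝔫`. -/
noncomputable def gaussDeriv (v : ℝ≥0) (p : Polynomial ℝ) : Polynomial ℝ :=
  Polynomial.derivative p - Polynomial.C (1 / (v : ℝ)) * Polynomial.X * p

theorem hasDerivAt_normalDensity (hv : 0 < v) (x : ℝ) :
    HasDerivAt (normalDensity v) (-(x / v) * normalDensity v x) x := by
  have hv' : (v : ℝ) ≠ 0 := by exact_mod_cast hv.ne'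
  have h : HasDerivAt (fun x : ℝ => -(x - 0) ^ 2 / (2 * v)) (-(x / v)) x := by
    have := (((hasDerivAt_id x).sub_const 0).pow 2).neg.div_const (2 * (v : ℝ))
    refine this.congr_deriv ?_
    simp only [id]; field_simp; simp; ring
  have h2 := (h.exp).const_mul ((√(2 * Real.pi * v))⁻¹)
  refine (h2.congr_deriv ?_)
  simp only [normalDensity, gaussianPDFReal]; ring

theorem hasDerivAt_eval_mul_normalDensity (hv : 0 < v) (p : Polynomial ℝ) (x : ℝ) :
    HasDerivAt (fun x => p.eval x * normalDensity v x)
      ((gaussDeriv v p).eval x * normalDensity v x) x := by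
  refine ((p.hasDerivAt x).mul (hasDerivAt_normalDensity hv x)).congr_deriv ?_
  simp [gaussDeriv]; ring

theorem integrable_eval_mul_normalDensity (hv : 0 < v) (p : Polynomial ℝ) :
    Integrable fun x => p.eval x * normalDensity v x := by
  have hv' : (0 : ℝ) < v := by exact_mod_cast hv
  induction p using Polynomial.induction_on' with
  | add p q hp hq =>
    simp only [Polynomial.eval_add, add_mul]
    exact hp.add hq
  | monomial n a =>
    have h := (integrable_rpow_mul_exp_neg_mul_sq (b := 1 / (2 * v)) (by positivity)
      (s := n) (by have : (0 : ℝ) ≤ n := n.cast_nonneg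
                   linarith)).const_mul (a * (√(2 * Real.pi * v))⁻¹)
    refine h.congr (Eventually.of_forall fun x => ?_)
    simp only [Polynomial.eval_monomial, normalDensity, gaussianPDFReal, Real.rpow_natCast, sub_zero]
    rw [show -(1 / (2 * (v : ℝ))) * x ^ 2 = -x ^ 2 / (2 * v) by ring]
    ring

theorem setIntegral_Iic_gaussDeriv (hv : 0 < v) (p : Polynomial ℝ) (z : ℝ) :
    ∫ x in Set.Iic z, (gaussDeriv v p).eval x * normalDensity v x = p.eval z * normalDensity v z := by
  have h := tendsto_zero_of_hasDerivAt_of_integrableOn_Iic (a := z)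
    (fun x _ => hasDerivAt_eval_mul_normalDensity hv p x)
    (integrable_eval_mul_normalDensity hv _).integrableOn
    (integrable_eval_mul_normalDensity hv p).integrableOn
  rw [integral_Iic_of_hasDerivAt_of_tendsto'
    (fun x _ => hasDerivAt_eval_mul_normalDensity hv p x)
    (integrable_eval_mul_normalDensity hv _).integrableOn h, sub_zero]

/-- The function is the integral of its derivative from `-∞`, so the `L¹` norm of the derivative is
a bound. -/
theorem exists_bound_eval_mul_normalDensity (hv : 0 < v) (p : Polynomial ℝ) :
    ∃ M, ∀ x, |p.eval x * normalDensity v x| ≤ M := by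
  refine ⟨∫ x, |(gaussDeriv v p).eval x * normalDensity v x|, fun z => ?_⟩
  rw [← setIntegral_Iic_gaussDeriv hv]
  exact abs_integral_le_integral_abs.trans (setIntegral_le_integral
    (integrable_eval_mul_normalDensity hv _).abs (Eventually.of_forall fun _ => abs_nonneg _))

theorem integrable_exp_mul_ofReal {μ : Measure ℝ} {w : ℝ → ℝ} (hw : Integrable w μ) (t : ℝ) :
    Integrable (fun x : ℝ => Complex.exp (t * x * Complex.I) * w x) μ := by
  refine hw.ofReal.bdd_mul (c := 1) (Continuous.aestronglyMeasurable (by fun_prop)) ?_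
  refine Eventually.of_forall fun x => ?_
  rw [← Complex.ofReal_mul, Complex.norm_exp_ofReal_mul_I]

/-- Integration by parts. On the Fourier side `gaussDeriv` is multiplication by `-i t`, so Hermite
polynomials need not be computed. -/
theorem integral_exp_mul_gaussDeriv (hv : 0 < v) (p : Polynomial ℝ) (t : ℝ) :
    ∫ x : ℝ, Complex.exp (t * x * Complex.I) * ((gaussDeriv v p).eval x * normalDensity v x : ℝ) =
      -(t * Complex.I) *
        ∫ x : ℝ, Complex.exp (t * x * Complex.I) * (p.eval x * normalDensity v x : ℝ) := by
  have hu : ∀ x : ℝ, HasDerivAt (fun x : ℝ => Complex.exp (t * x * Complex.I))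
      (t * Complex.I * Complex.exp (t * x * Complex.I)) x := by
    intro x
    have h1 : HasDerivAt (fun x : ℝ => (t : ℂ) * x * Complex.I) (t * Complex.I) x := by
      have := ((Complex.ofRealCLM.hasDerivAt (x := x)).const_mul (t : ℂ)).mul_const Complex.I
      simpa using this
    exact h1.cexp.congr_deriv (by ring)
  have h1 := integrable_exp_mul_ofReal (integrable_eval_mul_normalDensity hv (gaussDeriv v p)) t
  have h2 := integrable_exp_mul_ofReal (integrable_eval_mul_normalDensity hv p) t
  rw [integral_mul_deriv_eq_deriv_mul_of_integrable (fun x _ => hu x)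
    (fun x _ => (hasDerivAt_eval_mul_normalDensity hv p x).ofReal_comp) h1
    (by simpa [Pi.mul_def, mul_assoc] using h2.const_mul (t * Complex.I)) h2,
    ← integral_const_mul, ← integral_neg]
  congr 1; ext x; ring

theorem integral_exp_mul_normalDensity (hv : 0 < v) (t : ℝ) :
    ∫ x : ℝ, Complex.exp (t * x * Complex.I) * (normalDensity v x : ℝ) =
      Complex.exp (-(v * t ^ 2 / 2)) := by
  have h := charFun_gaussianReal (μ := 0) (v := v) t
  rw [charFun_apply_real, integral_gaussianReal_eq_integral_smul hv.ne'] at h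
  rw [show (-(v * t ^ 2 / 2) : ℂ) = t * (0 : ℝ) * Complex.I - v * t ^ 2 / 2 by push_cast; ring, ← h]
  refine integral_congr_ae (Eventually.of_forall fun x => ?_)
  simp [normalDensity, mul_comm]

/-- The first Edgeworth density, with its distribution function and its Fourier transform. -/
theorem exists_edgeworth_density (hv : 0 < v) (a k : ℝ) :
    ∃ (P : Polynomial ℝ) (g : ℝ → ℝ → ℝ) (M : ℝ), ∀ s : ℝ, |s| ≤ 1 →
      Integrable (g s) ∧ (∀ x, |g s x| ≤ M) ∧
      (∀ z, ∫ x in Set.Iic z, g s x = normalCDF v z + P.eval z * s * normalDensity v z) ∧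
      (∀ z, |normalCDF v z + P.eval z * s * normalDensity v z| ≤ M) ∧
      ∀ t : ℝ, ∫ x : ℝ, Complex.exp (t * x * Complex.I) * g s x =
        Complex.exp (-(v * t ^ 2 / 2)) * (1 + s * (a * t * Complex.I + k * t ^ 3 * Complex.I)) := by
  -- The density correction is `gaussDeriv v P`, with transform `-i t * (-a + k (-i t)²) = i a t + i
  -- k t³` times the Gaussian; this fixes `P`.
  set P : Polynomial ℝ := Polynomial.C (-a) * 1 + Polynomial.C k * gaussDeriv v (gaussDeriv v 1)
    with hP
  have hone : ∀ x, (1 : Polynomial ℝ).eval x * normalDensity v x = normalDensity v x := by simp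
  have hn : Integrable (normalDensity v) := by
    simpa using integrable_eval_mul_normalDensity hv (1 : Polynomial ℝ)
  have hq := integrable_eval_mul_normalDensity hv (gaussDeriv v P)
  obtain ⟨M₁, hM₁⟩ := exists_bound_eval_mul_normalDensity hv (1 : Polynomial ℝ)
  obtain ⟨M₂, hM₂⟩ := exists_bound_eval_mul_normalDensity hv (gaussDeriv v P)
  obtain ⟨M₃, hM₃⟩ := exists_bound_eval_mul_normalDensity hv P
  have hM₁0 := (abs_nonneg _).trans (hM₁ 0)
  have hM₂0 := (abs_nonneg _).trans (hM₂ 0)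
  have hM₃0 := (abs_nonneg _).trans (hM₃ 0)
  have hN0 : 0 ≤ ∫ x, |normalDensity v x| := integral_nonneg fun _ => abs_nonneg _
  have hcdf : ∀ z, |normalCDF v z| ≤ ∫ x, |normalDensity v x| := fun z =>
    abs_integral_le_integral_abs.trans (setIntegral_le_integral hn.abs
      (Eventually.of_forall fun _ => abs_nonneg _))
  refine ⟨P, fun s x => normalDensity v x + s * ((gaussDeriv v P).eval x * normalDensity v x),
    M₁ + M₂ + M₃ + ∫ x, |normalDensity v x|, fun s hs => ⟨hn.add (hq.const_mul s), ?_, ?_, ?_, ?_⟩⟩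
  · intro x
    have h1 := hM₁ x
    rw [hone] at h1
    have h2 : |s * ((gaussDeriv v P).eval x * normalDensity v x)| ≤ M₂ := by
      rw [abs_mul]
      calc _ ≤ 1 * M₂ := by gcongr; exact hM₂ x
        _ = M₂ := one_mul _
    have := abs_add_le (normalDensity v x) (s * ((gaussDeriv v P).eval x * normalDensity v x))
    linarith
  · intro z
    rw [integral_add hn.integrableOn (hq.const_mul s).integrableOn, integral_const_mul,
      setIntegral_Iic_gaussDeriv hv, normalCDF]
    ring
  · intro z
    have h2 : |P.eval z * s * normalDensity v z| ≤ M₃ := by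
      rw [mul_right_comm, abs_mul]
      calc _ ≤ M₃ * 1 := by gcongr; exact hM₃ z
        _ = M₃ := mul_one _
    have := abs_add_le (normalCDF v z) (P.eval z * s * normalDensity v z)
    have := hcdf z
    linarith
  · intro t
    have i1 := integrable_exp_mul_ofReal hn t
    have i2 := integrable_exp_mul_ofReal hq t
    have e1 : ∀ x : ℝ, Complex.exp (t * x * Complex.I) *
        ((normalDensity v x + s * ((gaussDeriv v P).eval x * normalDensity v x) : ℝ) : ℂ) =
        Complex.exp (t * x * Complex.I) * (normalDensity v x : ℝ) + s *
          (Complex.exp (t * x * Complex.I) * ((gaussDeriv v P).eval x * normalDensity v x : ℝ)) :=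
      fun x => by push_cast; ring
    have e2 : ∀ x : ℝ, Complex.exp (t * x * Complex.I) * (P.eval x * normalDensity v x : ℝ) =
        -a * (Complex.exp (t * x * Complex.I) *
          ((1 : Polynomial ℝ).eval x * normalDensity v x : ℝ)) +
        k * (Complex.exp (t * x * Complex.I) *
          ((gaussDeriv v (gaussDeriv v 1)).eval x * normalDensity v x : ℝ)) := fun x => by
      rw [hP]; simp only [Polynomial.eval_add, Polynomial.eval_mul, Polynomial.eval_C]
      push_cast; ring
    have j1 := integrable_exp_mul_ofReal (integrable_eval_mul_normalDensity hv 1) t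
    have j2 := integrable_exp_mul_ofReal
      (integrable_eval_mul_normalDensity hv (gaussDeriv v (gaussDeriv v 1))) t
    simp_rw [e1]
    rw [integral_add i1 (i2.const_mul _), integral_const_mul, integral_exp_mul_gaussDeriv hv]
    simp_rw [e2]
    rw [integral_add (j1.const_mul _) (j2.const_mul _), integral_const_mul, integral_const_mul,
      integral_exp_mul_gaussDeriv hv, integral_exp_mul_gaussDeriv hv]
    simp_rw [hone]
    rw [integral_exp_mul_normalDensity hv]
    linear_combination (-(s : ℂ) * k * t ^ 3 * Complex.I * Complex.exp (-(v * t ^ 2 / 2))) *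
      Complex.I_sq
end GaussianPolynomial

/-! ### Taylor expansion of the leading eigenvalue and reality of its coefficients -/

section Expansion

/-- The fourth-order little-o expansion with its quartic term moved into the error, so four
derivatives suffice. -/
theorem exists_taylor_three {h : ℝ → ℝ} (hh : ContDiffAt ℝ 4 h 0) :
    ∃ C, ∀ᶠ t in 𝓝 (0 : ℝ), |h t - (h 0 + deriv h 0 * t + iteratedDeriv 2 h 0 / 2 * t ^ 2 +
      iteratedDeriv 3 h 0 / 6 * t ^ 3)| ≤ C * |t| ^ 4 := by
  obtain ⟨s, hs, hcs⟩ := hh.contDiffOn (m := 4) le_rfl (by simp)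
  obtain ⟨ε, hε, hball⟩ := Metric.mem_nhds_iff.1 hs
  have h0 : (0 : ℝ) ∈ Metric.ball (0 : ℝ) ε := Metric.mem_ball_self hε
  have ht := taylor_isLittleO (n := 4) (convex_ball (0 : ℝ) ε) h0 (hcs.mono hball)
  rw [Metric.isOpen_ball.nhdsWithin_eq h0] at ht
  refine ⟨1 + |iteratedDeriv 4 h 0 / 24|, ?_⟩
  filter_upwards [ht.def one_pos] with t ht
  rw [taylor_within_apply] at ht
  simp only [Finset.sum_range_succ, Finset.sum_range_zero, sub_zero,
    iteratedDerivWithin_of_isOpen Metric.isOpen_ball h0, Real.norm_eq_abs, abs_pow,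
    iteratedDeriv_zero, iteratedDeriv_one, smul_eq_mul, Nat.factorial] at ht
  norm_num at ht
  set T := h t - (h 0 + deriv h 0 * t + iteratedDeriv 2 h 0 / 2 * t ^ 2 +
      iteratedDeriv 3 h 0 / 6 * t ^ 3)
  have h1 : T = (T - iteratedDeriv 4 h 0 / 24 * t ^ 4) + iteratedDeriv 4 h 0 / 24 * t ^ 4 := by ring
  rw [h1]
  refine (abs_add_le _ _).trans ?_
  rw [add_mul, one_mul, abs_mul, abs_pow]
  gcongr
  refine (le_of_eq (congrArg _ ?_)).trans ht
  simp only [T]; ring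

theorem iteratedDeriv_eq_zero_of_even {h : ℝ → ℝ} (hh : ∀ᶠ t in 𝓝 (0 : ℝ), h (-t) = h t) {n : ℕ}
    (hn : Odd n) : iteratedDeriv n h 0 = 0 := by
  have h1 : iteratedDeriv n (fun t => h (-t)) 0 = iteratedDeriv n h 0 :=
    Filter.EventuallyEq.iteratedDeriv_eq n hh
  rw [iteratedDeriv_comp_neg, hn.neg_one_pow, neg_zero] at h1
  simp only [neg_smul, one_smul] at h1
  linarith

theorem iteratedDeriv_eq_zero_of_odd {h : ℝ → ℝ} (hh : ∀ᶠ t in 𝓝 (0 : ℝ), h (-t) = -h t) {n : ℕ}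
    (hn : Even n) : iteratedDeriv n h 0 = 0 := by
  have h1 : iteratedDeriv n (fun t => h (-t)) 0 = iteratedDeriv n (fun t => -h t) 0 :=
    Filter.EventuallyEq.iteratedDeriv_eq n hh
  have h2 : iteratedDeriv n (fun t => -h t) 0 = - iteratedDeriv n h 0 := iteratedDeriv_fun_neg n h 0
  rw [iteratedDeriv_comp_neg, hn.neg_one_pow, neg_zero, h2, one_smul] at h1
  linarith

/-- Taylor expansion of a Hermitian function: the coefficients alternate between real and
imaginary. -/
theorem exists_hermitian_taylor {f : ℝ → ℂ} (hf : ContDiffAt ℝ 4 f 0) (hf0 : f 0 = 0)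
    (hsym : ∀ᶠ t in 𝓝 (0 : ℝ), f (-t) = (starRingEnd ℂ) (f t)) :
    ∃ a b k C : ℝ, 0 < C ∧ ∀ᶠ t in 𝓝 (0 : ℝ),
      ‖f t - (a * t * Complex.I + b * t ^ 2 + k * t ^ 3 * Complex.I)‖ ≤ C * |t| ^ 4 := by
  have hre : ContDiffAt ℝ 4 (fun t => (f t).re) 0 := Complex.reCLM.contDiff.contDiffAt.comp 0 hf
  have him : ContDiffAt ℝ 4 (fun t => (f t).im) 0 := Complex.imCLM.contDiff.contDiffAt.comp 0 hf
  have hev : ∀ᶠ t in 𝓝 (0 : ℝ), (f (-t)).re = (f t).re := hsym.mono fun t h => by simp [h]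
  have hod : ∀ᶠ t in 𝓝 (0 : ℝ), (f (-t)).im = -(f t).im := hsym.mono fun t h => by simp [h]
  obtain ⟨C₁, h1⟩ := exists_taylor_three hre
  obtain ⟨C₂, h2⟩ := exists_taylor_three him
  have d1 : deriv (fun t => (f t).re) 0 = 0 := by
    rw [← iteratedDeriv_one]; exact iteratedDeriv_eq_zero_of_even hev (by decide)
  rw [d1, iteratedDeriv_eq_zero_of_even hev (n := 3) (by decide)] at h1
  rw [iteratedDeriv_eq_zero_of_odd hod (n := 2) (by decide)] at h2
  refine ⟨deriv (fun t => (f t).im) 0, iteratedDeriv 2 (fun t => (f t).re) 0 / 2,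
    iteratedDeriv 3 (fun t => (f t).im) 0 / 6, |C₁| + |C₂| + 1, by positivity, ?_⟩
  filter_upwards [h1, h2] with t h1 h2
  refine (Complex.norm_le_abs_re_add_abs_im _).trans ?_
  have e1 : |t| ^ 4 * C₁ ≤ |t| ^ 4 * |C₁| := by gcongr; exact le_abs_self _
  have e2 : |t| ^ 4 * C₂ ≤ |t| ^ 4 * |C₂| := by gcongr; exact le_abs_self _
  have e3 : 0 ≤ |t| ^ 4 := by positivity
  have a1 : |(f t - ((deriv (fun t => (f t).im) 0 : ℝ) * t * Complex.I +
      (iteratedDeriv 2 (fun t => (f t).re) 0 / 2 : ℝ) * t ^ 2 +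
      (iteratedDeriv 3 (fun t => (f t).im) 0 / 6 : ℝ) * t ^ 3 * Complex.I)).re| ≤ C₁ * |t| ^ 4 := by
    convert h1 using 2
    simp [hf0, ← Complex.ofReal_pow]
  have a2 : |(f t - ((deriv (fun t => (f t).im) 0 : ℝ) * t * Complex.I +
      (iteratedDeriv 2 (fun t => (f t).re) 0 / 2 : ℝ) * t ^ 2 +
      (iteratedDeriv 3 (fun t => (f t).im) 0 / 6 : ℝ) * t ^ 3 * Complex.I)).im| ≤ C₂ * |t| ^ 4 := by
    convert h2 using 2
    simp [hf0, ← Complex.ofReal_pow]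
  linarith

/-- The leading geometric term of a sequence is determined up to exponentially smaller errors. -/
theorem eq_of_geometric_eq {a b l m : ℂ} {C θ : ℝ} {e : ℕ → ℂ} (ha : a ≠ 0) (hθ : 0 < θ)
    (hl : θ < ‖l‖) (he : ∀ N, 1 ≤ N → ‖e N‖ ≤ C * θ ^ N)
    (h : ∀ N, 1 ≤ N → l ^ N * a = m ^ N * b + e N) : l = m ∧ a = b := by
  have hl0 : l ≠ 0 := norm_pos_iff.1 (hθ.trans hl)
  have hb : Tendsto (fun N : ℕ => (m / l) ^ N * b) atTop (𝓝 a) := by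
    have h1 : Tendsto (fun N : ℕ => C * (θ / ‖l‖) ^ N) atTop (𝓝 0) := by
      simpa using (tendsto_pow_atTop_nhds_zero_of_lt_one (by positivity)
        ((div_lt_one (hθ.trans hl)).2 hl)).const_mul C
    have h2 : Tendsto (fun N : ℕ => e N / l ^ N) atTop (𝓝 0) := by
      refine squeeze_zero_norm' ?_ h1
      filter_upwards [eventually_ge_atTop 1] with N hN
      rw [norm_div, norm_pow, div_pow, ← mul_div_assoc]
      gcongr
      exact he N hN
    have h3 := h2.const_sub a
    rw [sub_zero] at h3
    refine h3.congr' ?_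
    filter_upwards [eventually_ge_atTop 1] with N hN
    rw [div_pow, eq_comm, eq_sub_iff_add_eq]
    field_simp
    exact (h N hN).symm
  have h1 := (tendsto_add_atTop_iff_nat 1).2 hb
  have h2 := hb.const_mul (m / l)
  -- The limit `a` of `(m / l) ^ N * b` is unchanged by the index shift `N + 1`, which multiplies it
  -- by `m / l`; as `a ≠ 0`, the ratio is `1`.
  have h3 : m / l * a = a := by
    refine tendsto_nhds_unique h2 (h1.congr fun N => ?_)
    ring
  have h4 : m / l = 1 := mul_right_cancel₀ ha (by rw [h3, one_mul])
  refine ⟨((div_eq_one_iff_eq hl0).1 h4).symm, ?_⟩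
  simp only [h4, one_pow, one_mul] at hb
  exact tendsto_nhds_unique hb tendsto_const_nhds |>.symm ▸ rfl

/-- Cumulant expansion of a family of characteristic functions with a leading exponential term. -/
theorem exists_cumulant_expansion {φ : ℕ → ℝ → ℂ} (hφ0 : ∀ N, φ N 0 = 1)
    (hφ1 : ∀ N t, ‖φ N t‖ ≤ 1) (hφs : ∀ N t, φ N (-t) = (starRingEnd ℂ) (φ N t))
    {lam w : ℝ → ℂ} {r : ℕ → ℝ → ℂ} {C θ c : ℝ} (hlam : ContDiffAt ℝ 4 lam 0)
    (hw : ContDiffAt ℝ 4 w 0) (hlam0 : lam 0 = 1) (hC : 0 < C) (hθ : 0 < θ) (hθ1 : θ < 1)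
    (hc : 0 < c) (h : ∀ t : ℝ, |t| ≤ c → ∀ N : ℕ, 1 ≤ N →
        φ N t = lam t ^ N * w t + r N t ∧ ‖r N t‖ ≤ C * θ ^ N ∧
        ‖r N t - r N 0‖ ≤ C * N * θ ^ N * |t|) :
    ∃ (A a k : ℝ) (v : ℝ≥0) (ψ : ℝ → ℂ) (C' c' : ℝ), 0 < C' ∧ 0 < c' ∧ ∀ t : ℝ, |t| ≤ c' →
      ‖ψ t - (-(v * t ^ 2 / 2) + k * t ^ 3 * Complex.I)‖ ≤ C' * |t| ^ 4 ∧
      ‖w t - (1 + a * t * Complex.I)‖ ≤ C' * |t| ^ 2 ∧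
      ∀ N : ℕ, 1 ≤ N → ‖φ N t - Complex.exp (N * (A * t * Complex.I + ψ t)) * w t‖
        ≤ C' * N * θ ^ N * |t| := by
  have hc0 : |(0 : ℝ)| ≤ c := by simpa using hc.le
  -- At `t = 0` the characteristic function is `1`, so uniqueness of the leading geometric term
  -- gives `w 0 = 1`. Hence `r N 0 = 0`, and the bound on `r N t - r N 0` becomes one on `r N t`.
  obtain ⟨-, hw0⟩ : (1 : ℂ) = lam 0 ∧ (1 : ℂ) = w 0 := by
    refine eq_of_geometric_eq (C := C) (θ := θ) (e := fun N => r N 0) one_ne_zero hθ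
      (by simpa using hθ1) (fun N hN => (h 0 hc0 N hN).2.1) fun N hN => ?_
    rw [← (h 0 hc0 N hN).1, hφ0]; simp
  have hr0 : ∀ N, 1 ≤ N → r N 0 = 0 := fun N hN => by
    have := (h 0 hc0 N hN).1
    rw [hφ0, hlam0, ← hw0] at this
    simpa using this
  have hneg : Tendsto (fun t : ℝ => -t) (𝓝 0) (𝓝 0) := by
    simpa using (continuous_neg (G := ℝ)).tendsto 0
  have hball : ∀ᶠ t in 𝓝 (0 : ℝ), |t| ≤ c :=
    (continuous_abs.tendsto' 0 0 abs_zero).eventually_le_const hc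
  have hlamθ : ∀ᶠ t in 𝓝 (0 : ℝ), θ < ‖lam t‖ :=
    hlam.continuousAt.norm.eventually_const_lt (by simpa [hlam0] using hθ1)
  have hwne : ∀ᶠ t in 𝓝 (0 : ℝ), w t ≠ 0 :=
    hw.continuousAt.eventually_ne (by rw [← hw0]; exact one_ne_zero)
  -- Hermitian symmetry of the characteristic functions passes to `lam` and `w` by the same
  -- uniqueness.
  have hsym : ∀ᶠ t in 𝓝 (0 : ℝ), lam (-t) = (starRingEnd ℂ) (lam t) ∧
      w (-t) = (starRingEnd ℂ) (w t) := by
    filter_upwards [hball, hneg.eventually hlamθ, hneg.eventually hwne] with t h1 h2 h3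
    refine eq_of_geometric_eq (C := C + C) (θ := θ)
      (e := fun N => (starRingEnd ℂ) (r N t) - r N (-t)) h3 hθ h2 (fun N hN => ?_) fun N hN => ?_
    · refine (norm_sub_le _ _).trans ?_
      rw [RCLike.norm_conj, add_mul]
      exact add_le_add (h t h1 N hN).2.1 (h (-t) (by rwa [abs_neg]) N hN).2.1
    · have e1 := (h (-t) (by rwa [abs_neg]) N hN).1
      have e2 := congrArg (starRingEnd ℂ) (h t h1 N hN).1
      rw [hφs, e2, map_add, map_mul, map_pow] at e1
      linear_combination -e1
  have hlam1 : ∀ᶠ t in 𝓝 (0 : ℝ), ‖lam t‖ ≤ 1 := by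
    filter_upwards [hball, hwne] with t h1 h2
    by_contra! hcon
    have h3 := (tendsto_pow_atTop_atTop_of_one_lt hcon).eventually_gt_atTop ((1 + C) / ‖w t‖)
    obtain ⟨N, hN1, hN2⟩ := (h3.and (eventually_ge_atTop 1)).exists
    obtain ⟨e1, e2, -⟩ := h t h1 N hN2
    rw [div_lt_iff₀ (norm_pos_iff.2 h2), ← norm_pow, ← norm_mul] at hN1
    have e3 : lam t ^ N * w t = φ N t - r N t := by rw [e1]; ring
    have e4 := norm_sub_le (φ N t) (r N t)
    rw [← e3] at e4
    have e5 := hφ1 N t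
    have e6 : θ ^ N ≤ 1 := pow_le_one₀ hθ.le hθ1.le
    nlinarith
  have hslit : ∀ᶠ t in 𝓝 (0 : ℝ), lam t ∈ Complex.slitPlane :=
    hlam.continuousAt.eventually (Complex.isOpen_slitPlane.mem_nhds (by
      rw [hlam0]; exact Complex.one_mem_slitPlane))
  have hlog : ContDiffAt ℝ 4 (fun t => Complex.log (lam t)) 0 := by
    refine ((Complex.contDiffAt_log (n := 4) ?_).restrict_scalars ℝ).comp (0 : ℝ) hlam
    rw [hlam0]; exact Complex.one_mem_slitPlane
  obtain ⟨A, b, k, C₁, hC₁, hL⟩ := exists_hermitian_taylor hlog (by simp [hlam0]) (by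
    filter_upwards [hsym, hslit] with t h1 h2
    rw [h1.1, Complex.log_conj _ (Complex.slitPlane_arg_ne_pi h2)])
  obtain ⟨a, b', k', C₂, hC₂, hW⟩ := exists_hermitian_taylor (hw.sub (contDiffAt_const (c := 1)))
    (by simp [← hw0]) (by
      filter_upwards [hsym] with t h1
      simp [h1.2])
  -- The real part of `log (lam t)` is `log ‖lam t‖ ≤ 0`; dividing its expansion by `t²` and letting
  -- `t → 0` shows that the variance `-2 b` is nonnegative.
  have hb : b ≤ 0 := by
    have h1 : ∀ᶠ t in 𝓝[>] (0 : ℝ), b ≤ C₁ * t ^ 2 := by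
      filter_upwards [nhdsWithin_le_nhds hL, nhdsWithin_le_nhds hlam1, self_mem_nhdsWithin]
        with t h1 h2 ht
      have ht' : (0 : ℝ) < t := ht
      have h3 := (Complex.abs_re_le_norm _).trans h1
      have h4 : (Complex.log (lam t)).re ≤ 0 := by
        rw [Complex.log_re]; exact Real.log_nonpos (norm_nonneg _) h2
      have h5 := (abs_le.1 h3).1
      simp [← Complex.ofReal_pow] at h5
      rw [abs_of_pos ht'] at h5
      have h6 : b * t ^ 2 ≤ C₁ * t ^ 2 * t ^ 2 := by nlinarith
      exact le_of_mul_le_mul_right h6 (by positivity)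
    have h2 : Tendsto (fun t : ℝ => C₁ * t ^ 2) (𝓝[>] 0) (𝓝 0) := by
      have : Continuous fun t : ℝ => C₁ * t ^ 2 := by fun_prop
      exact (this.tendsto' 0 0 (by simp)).mono_left nhdsWithin_le_nhds
    exact ge_of_tendsto h2 h1
  obtain ⟨c', hc', hcs⟩ := Metric.nhds_basis_closedBall.eventually_iff.1
    (hL.and (hW.and (hslit.and hball)))
  obtain ⟨v, hv⟩ : ∃ v : ℝ≥0, (v : ℝ) = -2 * b := ⟨⟨-2 * b, by linarith⟩, rfl⟩
  refine ⟨A, a, k, v, fun t => Complex.log (lam t) - A * t * Complex.I,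
    C₁ + |b'| + |k'| + C₂ + C, min c' 1, by positivity, by positivity, fun t ht => ?_⟩
  have ht1 : |t| ≤ 1 := ht.trans (min_le_right _ _)
  obtain ⟨h1, h2, h3, h4⟩ := hcs (show t ∈ Metric.closedBall (0 : ℝ) c' by
    simpa using ht.trans (min_le_left _ _))
  have hb' := abs_nonneg b'
  have hk' := abs_nonneg k'
  refine ⟨?_, ?_, fun N hN => ?_⟩
  · have e1 : Complex.log (lam t) - A * t * Complex.I -
        (-((v : ℝ) * t ^ 2 / 2) + k * t ^ 3 * Complex.I) =
        Complex.log (lam t) - (A * t * Complex.I + b * t ^ 2 + k * t ^ 3 * Complex.I) := by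
      rw [hv]; push_cast; ring
    beta_reduce
    rw [e1]
    refine h1.trans ?_
    gcongr
    linarith
  · have e1 : w t - (1 + a * t * Complex.I) = (w t - 1 - (a * t * Complex.I + b' * t ^ 2 +
        k' * t ^ 3 * Complex.I)) + ((b' : ℂ) * t ^ 2 + k' * t ^ 3 * Complex.I) := by ring
    rw [e1]
    have e2 : ‖(b' : ℂ) * t ^ 2‖ = |b'| * |t| ^ 2 := by simp
    have e3 : ‖(k' : ℂ) * t ^ 3 * Complex.I‖ = |k'| * |t| ^ 3 := by simp
    have e4 : |t| ^ 3 ≤ |t| ^ 2 := pow_le_pow_of_le_one (abs_nonneg _) ht1 (by norm_num)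
    have e5 : |t| ^ 4 ≤ |t| ^ 2 := pow_le_pow_of_le_one (abs_nonneg _) ht1 (by norm_num)
    have e6 := norm_add_le (w t - 1 - (a * t * Complex.I + b' * t ^ 2 + k' * t ^ 3 * Complex.I))
      ((b' : ℂ) * t ^ 2 + k' * t ^ 3 * Complex.I)
    have e7 := norm_add_le ((b' : ℂ) * t ^ 2) (k' * t ^ 3 * Complex.I)
    have e8 : 0 ≤ |t| ^ 2 := by positivity
    have e9 := mul_le_mul_of_nonneg_left e4 hk'
    have e10 := mul_le_mul_of_nonneg_left e5 hC₂.le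
    nlinarith
  · obtain ⟨e1, -, e3⟩ := h t h4 N hN
    have hne : lam t ≠ 0 := Complex.slitPlane_ne_zero h3
    have e4 : Complex.exp (N * (A * t * Complex.I + (Complex.log (lam t) - A * t * Complex.I)))
        = lam t ^ N := by
      rw [add_sub_cancel, Complex.exp_nat_mul, Complex.exp_log hne]
    rw [e4, e1, add_sub_cancel_left]
    rw [hr0 N hN, sub_zero] at e3
    refine e3.trans ?_
    gcongr
    linarith

end Expansion

/-! ### Central and high-frequency estimates -/

section Estimates

theorem exists_natCast_pow_mul_pow_le {θ : ℝ} (hθ : 0 ≤ θ) (hθ1 : θ < 1) (k : ℕ) :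
    ∃ C : ℝ, 0 < C ∧ ∀ N : ℕ, (N : ℝ) ^ k * θ ^ N ≤ C := by
  obtain ⟨C, hC⟩ := (tendsto_pow_const_mul_const_pow_of_lt_one k hθ hθ1).bddAbove_range
  exact ⟨|C| + 1, by positivity, fun N =>
    (hC ⟨N, rfl⟩).trans ((le_abs_self C).trans (by linarith))⟩

/-- Odd powers lie below neighbouring even ones, which the exponential series dominates. They arise
from `t² + t⁴ + t⁶` once the factor `t` needed for smoothing is split off. -/
theorem odd_powers_le_exp {q : ℝ} (hq : 0 < q) (t : ℝ) :
    t + t ^ 3 + t ^ 5 ≤ (1 + 2 / q + 4 / q ^ 2 + 6 / q ^ 3) * Real.exp (q * t ^ 2) := by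
  have hp : 0 ≤ q * t ^ 2 := by positivity
  have h0 : 1 ≤ Real.exp (q * t ^ 2) := Real.one_le_exp hp
  have h1 := Real.pow_div_factorial_le_exp _ hp 1
  have h2 := Real.pow_div_factorial_le_exp _ hp 2
  have h3 := Real.pow_div_factorial_le_exp _ hp 3
  set X := Real.exp (q * t ^ 2)
  have e1 : t ^ 2 ≤ 1 / q * X := by
    rw [div_mul_eq_mul_div, le_div_iff₀ hq]
    simp at h1; linarith
  have e2 : t ^ 4 ≤ 2 / q ^ 2 * X := by
    rw [div_mul_eq_mul_div, le_div_iff₀ (by positivity)]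
    norm_num [Nat.factorial] at h2
    nlinarith
  have e3 : t ^ 6 ≤ 6 / q ^ 3 * X := by
    rw [div_mul_eq_mul_div, le_div_iff₀ (by positivity)]
    norm_num [Nat.factorial] at h3
    nlinarith
  have f1 : t ≤ 1 + t ^ 2 := by nlinarith [sq_nonneg (t - 1)]
  have f2 : t ^ 3 ≤ t ^ 2 + t ^ 4 := by nlinarith [mul_le_mul_of_nonneg_left f1 (sq_nonneg t)]
  have f3 : t ^ 5 ≤ t ^ 4 + t ^ 6 := by
    nlinarith [mul_le_mul_of_nonneg_left f1 (by positivity : 0 ≤ t ^ 4)]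
  calc t + t ^ 3 + t ^ 5 ≤ 1 + 2 * t ^ 2 + 2 * t ^ 4 + t ^ 6 := by linarith
    _ ≤ X + 2 * (1 / q * X) + 2 * (2 / q ^ 2 * X) + 6 / q ^ 3 * X := by gcongr
    _ = _ := by ring

/-- Exact decomposition into the second-order error of `exp Y`, the errors of `Y` and `W` against
their leading parts, and the cross term `K * (W - 1)`. -/
theorem norm_exp_mul_sub_le (Y W K α : ℂ) :
    ‖Complex.exp Y * W - (1 + (α + K))‖ ≤ ‖Y‖ ^ 2 * Real.exp ‖Y‖ * ‖W‖ + ‖Y - K‖ * ‖W‖ +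
      ‖W - (1 + α)‖ + ‖K‖ * ‖W - 1‖ := by
  have h : Complex.exp Y * W - (1 + (α + K)) = (Complex.exp Y - (1 + Y)) * W + (Y - K) * W +
      (W - (1 + α)) + K * (W - 1) := by ring
  have h2 := Complex.norm_exp_sub_sum_le_norm_mul_exp Y 2
  simp only [Finset.sum_range_succ, Finset.sum_range_zero, pow_zero, pow_one, Nat.factorial] at h2
  norm_num at h2
  rw [h]
  refine (norm_add_le _ _).trans (add_le_add ((norm_add_le _ _).trans (add_le_add
    ((norm_add_le _ _).trans (add_le_add ?_ (norm_mul_le _ _))) le_rfl)) (norm_mul_le _ _))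
  rw [norm_mul]
  gcongr

/-- The Edgeworth approximation of the leading term in the central range of frequencies. -/
theorem exists_central_estimate {a k v C' c' : ℝ} (hv : 0 < v) (hC' : 0 < C') (hc' : 0 < c')
    {ψ w : ℝ → ℂ}
    (hψ : ∀ t : ℝ, |t| ≤ c' →
      ‖ψ t - (-(v * t ^ 2 / 2) + k * t ^ 3 * Complex.I)‖ ≤ C' * |t| ^ 4)
    (hw : ∀ t : ℝ, |t| ≤ c' → ‖w t - (1 + a * t * Complex.I)‖ ≤ C' * |t| ^ 2) :
    ∃ C c : ℝ, 0 < C ∧ 0 < c ∧ c ≤ c' ∧ c ≤ 1 ∧ ∀ s t : ℝ, 0 < s → 0 < t → t ≤ c * s →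
      ‖Complex.exp (s ^ 2 * ψ (t / s)) * w (t / s) - Complex.exp (-(v * t ^ 2 / 2)) *
        (1 + (1 / s : ℝ) * (a * t * Complex.I + k * t ^ 3 * Complex.I))‖
      ≤ t * (C / s ^ 2 * Real.exp (-(v / 8) * t ^ 2)) := by
  set H := 1 + C' + |a| with hH
  set D := |k| + C' with hD
  set M := D ^ 2 * H + C' * H + C' + |k| * (C' + |a|) with hM
  set Q := 1 + 2 / (v / 8) + 4 / (v / 8) ^ 2 + 6 / (v / 8) ^ 3 with hQ
  have hk := abs_nonneg k
  have ha := abs_nonneg a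
  have hD0 : 0 < D := by positivity
  -- The cap `v / (4 * D)` makes `‖Y‖ ≤ v t² / 4`. Of the Gaussian exponent `v / 2`, this spends `v
  -- / 4`, the polynomial factors another `v / 8`, and `v / 8` is left.
  refine ⟨M * Q, min (min c' 1) (v / (4 * D)), by positivity, by positivity,
    (min_le_left _ _).trans (min_le_left _ _), (min_le_left _ _).trans (min_le_right _ _), ?_⟩
  intro s t hs ht hts
  set x := t / s with hx
  have hx0 : 0 < x := by positivity
  have hxc : x ≤ min (min c' 1) (v / (4 * D)) := by rwa [hx, div_le_iff₀ hs]
  have hxc' : |x| ≤ c' := by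
    rw [abs_of_pos hx0]; exact hxc.trans ((min_le_left _ _).trans (min_le_left _ _))
  have hx1 : x ≤ 1 := hxc.trans ((min_le_left _ _).trans (min_le_right _ _))
  have hxD : x * D ≤ v / 4 := by
    have := hxc.trans (min_le_right _ _)
    rw [le_div_iff₀ (by positivity)] at this
    linarith
  have htx : t = x * s := by rw [hx]; field_simp
  have h1 := hψ x hxc'
  have h2 := hw x hxc'
  rw [abs_of_pos hx0] at h1 h2
  set W := w x
  -- `Y` is the exponent without its Gaussian part and `K` its cubic term.
  set Y : ℂ := s ^ 2 * ψ x + v * t ^ 2 / 2 with hY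
  set K : ℂ := s ^ 2 * (k * x ^ 3 * Complex.I) with hK
  have hsC : (s : ℂ) ≠ 0 := by exact_mod_cast hs.ne'
  have hYK : ‖Y - K‖ ≤ C' * x ^ 4 * s ^ 2 := by
    have : Y - K = s ^ 2 * (ψ x - (-(v * x ^ 2 / 2) + k * x ^ 3 * Complex.I)) := by
      rw [hY, hK, htx]; push_cast; ring
    rw [this, norm_mul, norm_pow, Complex.norm_real, Real.norm_of_nonneg hs.le, mul_comm]
    gcongr
  have hKn : ‖K‖ = |k| * x ^ 3 * s ^ 2 := by
    rw [hK]; simp [abs_of_pos hx0, abs_of_pos hs]; ring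
  have hYn : ‖Y‖ ≤ D * x ^ 3 * s ^ 2 := by
    have e1 : ‖Y‖ ≤ ‖Y - K‖ + ‖K‖ := by simpa using norm_add_le (Y - K) K
    have e2 : x ^ 4 ≤ x ^ 3 := pow_le_pow_of_le_one hx0.le hx1 (by norm_num)
    have e3 : C' * x ^ 4 * s ^ 2 ≤ C' * x ^ 3 * s ^ 2 := by gcongr
    rw [hKn] at e1
    rw [hD]
    linarith
  have hYn2 : ‖Y‖ ≤ v / 4 * t ^ 2 := by
    refine hYn.trans ?_
    rw [htx]
    have : D * x ^ 3 * s ^ 2 = (x * D) * (x * s) ^ 2 := by ring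
    rw [this]
    gcongr
  have hW1 : ‖W - 1‖ ≤ (C' + |a|) * x := by
    have e1 : W - 1 = (W - (1 + a * x * Complex.I)) + a * x * Complex.I := by ring
    have e2 : ‖(a : ℂ) * x * Complex.I‖ = |a| * x := by simp [abs_of_pos hx0]
    have e3 : C' * x ^ 2 ≤ C' * x := by
      gcongr; nlinarith
    rw [e1]
    refine (norm_add_le _ _).trans ?_
    rw [e2]; linarith
  have hWn : ‖W‖ ≤ H := by
    have e1 : ‖W‖ ≤ ‖W - 1‖ + ‖(1 : ℂ)‖ := by simpa using norm_add_le (W - 1) 1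
    rw [norm_one] at e1
    have : (C' + |a|) * x ≤ C' + |a| := by
      have : 0 ≤ C' + |a| := by positivity
      nlinarith
    rw [hH]; linarith
  have key := norm_exp_mul_sub_le Y W K (a * x * Complex.I)
  have hE1 : 1 ≤ Real.exp (v / 4 * t ^ 2) := Real.one_le_exp (by positivity)
  set E := Real.exp (v / 4 * t ^ 2) with hE
  have hH0 : 0 < H := by positivity
  have hbound : ‖Complex.exp Y * W - (1 + (a * x * Complex.I + K))‖ ≤
      M / s ^ 2 * (t * (t + t ^ 3 + t ^ 5)) * E := by
    refine key.trans ?_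
    have b1 : ‖Y‖ ^ 2 * Real.exp ‖Y‖ * ‖W‖ ≤ D ^ 2 * H * (t ^ 6 / s ^ 2) * E := by
      calc _ ≤ (D * x ^ 3 * s ^ 2) ^ 2 * E * H := by
            gcongr
            exact Real.exp_le_exp.2 hYn2
        _ = _ := by rw [hx]; field_simp
    have b2 : ‖Y - K‖ * ‖W‖ ≤ C' * H * (t ^ 4 / s ^ 2) * E := by
      calc _ ≤ (C' * x ^ 4 * s ^ 2) * H := by gcongr
        _ = C' * H * (t ^ 4 / s ^ 2) * 1 := by rw [hx]; field_simp
        _ ≤ _ := by gcongr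
    have b3 : ‖W - (1 + a * x * Complex.I)‖ ≤ C' * (t ^ 2 / s ^ 2) * E := by
      calc _ ≤ C' * x ^ 2 := h2
        _ = C' * (t ^ 2 / s ^ 2) * 1 := by rw [hx]; field_simp
        _ ≤ _ := by gcongr
    have b4 : ‖K‖ * ‖W - 1‖ ≤ |k| * (C' + |a|) * (t ^ 4 / s ^ 2) * E := by
      calc _ ≤ (|k| * x ^ 3 * s ^ 2) * ((C' + |a|) * x) := by rw [hKn]; gcongr
        _ = |k| * (C' + |a|) * (t ^ 4 / s ^ 2) * 1 := by rw [hx]; field_simp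
        _ ≤ _ := by gcongr
    have hZ : M / s ^ 2 * (t * (t + t ^ 3 + t ^ 5)) * E =
        M * ((t ^ 2 + t ^ 4 + t ^ 6) / s ^ 2) * E := by ring
    rw [hZ]
    set Z := (t ^ 2 + t ^ 4 + t ^ 6) / s ^ 2
    have z2 : t ^ 2 / s ^ 2 ≤ Z := by
      simp only [Z]; gcongr
      have := pow_pos ht 4
      have := pow_pos ht 6
      linarith
    have z4 : t ^ 4 / s ^ 2 ≤ Z := by
      simp only [Z]; gcongr
      have := pow_pos ht 2
      have := pow_pos ht 6
      linarith
    have z6 : t ^ 6 / s ^ 2 ≤ Z := by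
      simp only [Z]; gcongr
      have := pow_pos ht 2
      have := pow_pos ht 4
      linarith
    calc _ ≤ D ^ 2 * H * (t ^ 6 / s ^ 2) * E + C' * H * (t ^ 4 / s ^ 2) * E +
          C' * (t ^ 2 / s ^ 2) * E + |k| * (C' + |a|) * (t ^ 4 / s ^ 2) * E := by linarith
      _ ≤ D ^ 2 * H * Z * E + C' * H * Z * E + C' * Z * E + |k| * (C' + |a|) * Z * E := by gcongr
      _ = M * Z * E := by rw [hM]; ring
  have hfac : Complex.exp (s ^ 2 * ψ x) * W - Complex.exp (-(v * t ^ 2 / 2)) *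
        (1 + (1 / s : ℝ) * (a * t * Complex.I + k * t ^ 3 * Complex.I)) =
      Complex.exp (-(v * t ^ 2 / 2)) *
        (Complex.exp Y * W - (1 + (a * x * Complex.I + K))) := by
    have e1 : Complex.exp (s ^ 2 * ψ x) = Complex.exp (-(v * t ^ 2 / 2)) * Complex.exp Y := by
      rw [← Complex.exp_add, hY]; congr 1; ring
    have e2 : ((1 / s : ℝ) : ℂ) * (a * t * Complex.I + k * t ^ 3 * Complex.I) =
        a * x * Complex.I + K := by
      rw [hK, hx]; push_cast; field_simp
    rw [e1, e2]; ring
  have hgn : ‖Complex.exp (-(v * t ^ 2 / 2))‖ = Real.exp (-(v * t ^ 2 / 2)) := by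
    rw [Complex.norm_exp]; simp [← Complex.ofReal_pow, ← Complex.ofReal_mul]
  rw [hfac, norm_mul, hgn]
  have hodd := odd_powers_le_exp (q := v / 8) (by positivity) t
  have hexp : Real.exp (-(v * t ^ 2 / 2)) * (Real.exp (v / 8 * t ^ 2) * E) =
      Real.exp (-(v / 8) * t ^ 2) := by
    rw [hE, ← Real.exp_add, ← Real.exp_add]; congr 1; ring
  have hM0 : 0 ≤ M := by positivity
  calc Real.exp (-(v * t ^ 2 / 2)) * ‖Complex.exp Y * W - (1 + (a * x * Complex.I + K))‖
      ≤ Real.exp (-(v * t ^ 2 / 2)) * (M / s ^ 2 * (t * (Q * Real.exp (v / 8 * t ^ 2))) * E) := by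
        gcongr
        refine hbound.trans ?_
        gcongr
    _ = t * (M * Q / s ^ 2 * (Real.exp (-(v * t ^ 2 / 2)) * (Real.exp (v / 8 * t ^ 2) * E))) := by
        ring
    _ = _ := by rw [hexp]

variable {B : Type*} [NormedAddCommGroup B] [NormedSpace ℂ B] [CompleteSpace B]

/-- Away from zero frequency the iterates are `O(N⁻²)`, up to frequencies of order `N ^ r₁`. -/
theorem exists_high_frequency_bound {L : ℝ → B →L[ℂ] B} (hL : Continuous L)
    (hA3 : AssumptionA3 L) {r₁ : ℝ} (hA4 : AssumptionA4 L r₁) {c : ℝ} (hc : 0 < c) :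
    ∃ C c₂ : ℝ, 0 < C ∧ 0 < c₂ ∧ c₂ ≤ 1 ∧ ∃ N₁ : ℕ, ∀ N : ℕ, N₁ ≤ N → ∀ x : ℝ, c ≤ |x| →
      |x| ≤ c₂ * (N : ℝ) ^ r₁ → ‖L x ^ N‖ ≤ C / (N : ℝ) ^ 2 := by
  obtain ⟨hr₁, K, r₂, N₀, hK, hr₂, hN₀, hdec⟩ := hA4
  obtain ⟨C, θ, hC, hθ, hθ1, hcomp⟩ := exists_uniform_norm_pow_le hL
    (K := Metric.closedBall (0 : ℝ) K ∩ {x | c ≤ |x|})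
    ((isCompact_closedBall (0 : ℝ) K).inter_right (isClosed_le continuous_const continuous_abs))
    (fun t ht => hA3 t (by
      rintro rfl
      have : c ≤ |(0 : ℝ)| := ht.2
      simp at this; linarith))
  obtain ⟨C₁, hC₁, hgeo⟩ := exists_natCast_pow_mul_pow_le hθ.le hθ1 2
  -- As `r₂` may be small, `N` is cut into `k` blocks of length `m = N / (k + 1)`, giving `m ^ (-r₂
  -- k) ≤ m⁻²`, and a last block of length at least `m`, of norm at most one.
  obtain ⟨k, hk⟩ := exists_nat_ge (2 / r₂)
  rw [div_le_iff₀ hr₂] at hk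
  set j : ℝ := 2 * ((k : ℝ) + 1) with hj
  have hj1 : 1 ≤ j := by
    have : (0 : ℝ) ≤ k := k.cast_nonneg
    rw [hj]; linarith
  have hj0 : 0 < j := by linarith
  -- Since `m ≥ N / j`, the cutoff `(1 / j) ^ r₁ * N ^ r₁` stays below `m ^ r₁`, so (A4) applies to
  -- each block. The threshold on `N` ensures `m ≥ 1` and `m > N₀`.
  refine ⟨C * C₁ + j ^ 2, (1 / j) ^ r₁, by positivity, by positivity,
    Real.rpow_le_one (by positivity) (by rw [div_le_one hj0]; exact hj1) hr₁.le,
    ⌈j * N₀⌉₊ + k + 1, fun N hN x hx1 hx2 => ?_⟩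
  have hNk : k + 1 ≤ N := by omega
  have hNpos : (0 : ℝ) < N := by exact_mod_cast (by omega : 0 < N)
  by_cases hxK : |x| ≤ K
  · refine (hcomp x ⟨by simpa using hxK, hx1⟩ N).trans ?_
    rw [le_div_iff₀ (by positivity)]
    have := mul_le_mul_of_nonneg_left (hgeo N) hC.le
    have : 0 < j ^ 2 := by positivity
    linarith
  · have hxK' : K ≤ |x| := (not_le.1 hxK).le
    set m := N / (k + 1) with hm
    have hm1 : 1 ≤ m := Nat.one_le_iff_ne_zero.2 (Nat.div_pos hNk (by omega)).ne'
    have hmj : (N : ℝ) / j ≤ m := by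
      have h1 : N < (m + 1) * (k + 1) := by
        rw [hm, mul_comm]; exact Nat.lt_mul_div_succ N k.succ_pos
      have h2 : (N : ℝ) < (m + 1) * (k + 1) := by exact_mod_cast h1
      have h3 : (1 : ℝ) ≤ m := by exact_mod_cast hm1
      rw [div_le_iff₀ hj0, hj]
      have : (0 : ℝ) ≤ k := k.cast_nonneg
      nlinarith
    have hmN : N₀ < m := by
      refine lt_of_lt_of_le ?_ hmj
      rw [lt_div_iff₀ hj0, mul_comm]
      have h1 : j * N₀ ≤ ⌈j * N₀⌉₊ := Nat.le_ceil _
      have h2 : (⌈j * N₀⌉₊ : ℝ) < N := by exact_mod_cast (by omega : ⌈j * N₀⌉₊ < N)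
      linarith
    have hmul : m * (k + 1) ≤ N := Nat.div_mul_le_self _ _
    have hrest : m ≤ N - m * k := by
      have : m * (k + 1) = m * k + m := by ring
      omega
    have hxm : |x| ≤ (m : ℝ) ^ r₁ := by
      refine hx2.trans ?_
      rw [← Real.mul_rpow (by positivity) hNpos.le, one_div_mul_eq_div]
      exact Real.rpow_le_rpow (by positivity) hmj hr₁.le
    have hm0 : (0 : ℝ) < m := by exact_mod_cast hm1
    have h1 := hdec m x hmN hxK' hxm
    have hrest' : (m : ℝ) ≤ ((N - m * k : ℕ) : ℝ) := by exact_mod_cast hrest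
    have h2 := hdec (N - m * k) x (hmN.trans_le hrest') hxK'
      (hxm.trans (Real.rpow_le_rpow hm0.le hrest' hr₁.le))
    have h3 : ‖L x ^ (N - m * k)‖ ≤ 1 := by
      refine h2.trans ?_
      rw [div_le_one (Real.rpow_pos_of_pos (hm0.trans_le hrest') _)]
      exact Real.one_le_rpow (by
        have : (1 : ℝ) ≤ m := by exact_mod_cast hm1
        linarith) hr₂.le
    have hsplit : L x ^ N = (L x ^ m) ^ k * L x ^ (N - m * k) := by
      rw [← pow_mul, ← pow_add]; congr 1
      have : m * (k + 1) = m * k + m := by ring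
      omega
    have h4 : ‖(L x ^ m) ^ k‖ ≤ (1 / (m : ℝ) ^ r₂) ^ k := by
      rcases Nat.eq_zero_or_pos k with hk0 | hk0
      · exfalso
        rw [hk0] at hk; simp at hk; linarith
      · exact (norm_pow_le' _ hk0).trans (pow_le_pow_left₀ (norm_nonneg _) h1 k)
    have h5 : (1 / (m : ℝ) ^ r₂) ^ k ≤ 1 / (m : ℝ) ^ 2 := by
      rw [div_pow, one_pow, ← Real.rpow_natCast ((m : ℝ) ^ r₂), ← Real.rpow_mul hm0.le]
      gcongr
      rw [← Real.rpow_natCast]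
      refine Real.rpow_le_rpow_of_exponent_le (by exact_mod_cast hm1) ?_
      push_cast; linarith
    calc ‖L x ^ N‖ ≤ ‖(L x ^ m) ^ k‖ * ‖L x ^ (N - m * k)‖ := by
          rw [hsplit]; exact norm_mul_le _ _
      _ ≤ 1 / (m : ℝ) ^ 2 * 1 := by
          gcongr
          exact h4.trans h5
      _ ≤ j ^ 2 / (N : ℝ) ^ 2 := by
          have : (N : ℝ) ≤ m * j := by rwa [div_le_iff₀ hj0] at hmj
          rw [mul_one, div_le_div_iff₀ (by positivity) (by positivity), one_mul, mul_comm,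
            ← mul_pow]
          exact pow_le_pow_left₀ hNpos.le this 2
      _ ≤ _ := by
          gcongr
          have : 0 < C * C₁ := by positivity
          linarith

end Estimates

/-! ### Characteristic functions of the normalised sums -/

section Main

variable {Ω : Type*} [MeasurableSpace Ω] {P : Measure Ω} [IsProbabilityMeasure P] {X : ℕ → Ω → ℝ}

theorem measurable_partialSum (hX : ∀ n, Measurable (X n)) (N : ℕ) :
    Measurable (partialSum X N) := by
  unfold partialSum; fun_prop

theorem measurable_normalizedSum (hX : ∀ n, Measurable (X n)) (A : ℝ) (N : ℕ) :
    Measurable (normalizedSum X A N) :=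
  ((measurable_partialSum hX N).sub_const _).div_const _

omit [IsProbabilityMeasure P] in
theorem charFun_normalizedSum (hX : ∀ n, Measurable (X n)) (A : ℝ) {N : ℕ} (hN : 1 ≤ N) (t : ℝ) :
    charFun (P.map (normalizedSum X A N)) t =
      Complex.exp (-(N * (A * (t / √(N : ℝ) : ℝ) * Complex.I))) *
        ∫ ω, Complex.exp (Complex.I * ((t / √(N : ℝ) : ℝ) : ℂ) * (partialSum X N ω : ℂ)) ∂P := by
  have hs : √(N : ℝ) ≠ 0 := by
    have : (0 : ℝ) < N := by exact_mod_cast hN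
    positivity
  rw [charFun_apply_real, integral_map (measurable_normalizedSum hX A N).aemeasurable
    (Continuous.aestronglyMeasurable (by fun_prop)), ← integral_const_mul]
  refine integral_congr_ae (Eventually.of_forall fun ω => ?_)
  beta_reduce
  rw [← Complex.exp_add]
  congr 1
  have hsC : ((√(N : ℝ) : ℝ) : ℂ) ≠ 0 := by exact_mod_cast hs
  simp only [normalizedSum]
  push_cast
  field_simp
  ring

/-- Convergence of characteristic functions from the cumulant expansion. -/
theorem tendsto_exp_mul_of_cumulant {a k v C' c' : ℝ} (hc' : 0 < c') {ψ w : ℝ → ℂ}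
    (hψ : ∀ t : ℝ, |t| ≤ c' →
      ‖ψ t - (-(v * t ^ 2 / 2) + k * t ^ 3 * Complex.I)‖ ≤ C' * |t| ^ 4)
    (hw : ∀ t : ℝ, |t| ≤ c' → ‖w t - (1 + a * t * Complex.I)‖ ≤ C' * |t| ^ 2)
    {s : ℕ → ℝ} (hs : Tendsto s atTop atTop) (t : ℝ) :
    Tendsto (fun N => Complex.exp ((s N : ℂ) ^ 2 * ψ (t / s N)) * w (t / s N)) atTop
      (𝓝 (Complex.exp (-(v * t ^ 2 / 2)))) := by
  have hx : Tendsto (fun N => t / s N) atTop (𝓝 0) := hs.const_div_atTop t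
  have hxc : ∀ᶠ N in atTop, |t / s N| ≤ c' := by
    have := hx.abs
    rw [abs_zero] at this
    exact this.eventually_le_const hc'
  have hs0 := hs.eventually_gt_atTop 0
  have h1 : Tendsto (fun N => (s N : ℂ) ^ 2 * ψ (t / s N)) atTop (𝓝 (-(v * t ^ 2 / 2))) := by
    rw [tendsto_iff_norm_sub_tendsto_zero]
    have hb : Tendsto (fun N => (C' * |t / s N| ^ 2 + |k| * |t / s N|) * t ^ 2) atTop (𝓝 0) := by
      have hcont : Continuous fun x : ℝ => (C' * |x| ^ 2 + |k| * |x|) * t ^ 2 := by fun_prop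
      exact (hcont.tendsto' 0 0 (by simp)).comp hx
    refine squeeze_zero' (Eventually.of_forall fun _ => norm_nonneg _) ?_ hb
    filter_upwards [hxc, hs0] with N h1 h2
    have h3 := hψ _ h1
    set x := t / s N with hxdef
    have htx : t = x * s N := by rw [hxdef]; field_simp
    have e1 : (s N : ℂ) ^ 2 * ψ x - -(v * t ^ 2 / 2) =
        s N ^ 2 * ((ψ x - (-(v * x ^ 2 / 2) + k * x ^ 3 * Complex.I)) + k * x ^ 3 * Complex.I) := by
      rw [htx]; push_cast; ring
    have e2 : ‖(k : ℂ) * x ^ 3 * Complex.I‖ = |k| * |x| ^ 3 := by simp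
    rw [e1, norm_mul, norm_pow, Complex.norm_real, Real.norm_of_nonneg h2.le]
    calc s N ^ 2 * ‖(ψ x - (-(v * x ^ 2 / 2) + k * x ^ 3 * Complex.I)) + k * x ^ 3 * Complex.I‖
        ≤ s N ^ 2 * (C' * |x| ^ 4 + |k| * |x| ^ 3) := by
          gcongr
          refine (norm_add_le _ _).trans ?_
          rw [e2]; gcongr
      _ = (C' * |x| ^ 2 + |k| * |x|) * (|x| ^ 2 * s N ^ 2) := by ring
      _ = _ := by rw [sq_abs, ← mul_pow, ← htx]
  have h2 : Tendsto (fun N => w (t / s N)) atTop (𝓝 1) := by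
    rw [tendsto_iff_norm_sub_tendsto_zero]
    have hb : Tendsto (fun N => C' * |t / s N| ^ 2 + |a| * |t / s N|) atTop (𝓝 0) := by
      have hcont : Continuous fun x : ℝ => C' * |x| ^ 2 + |a| * |x| := by fun_prop
      exact (hcont.tendsto' 0 0 (by simp)).comp hx
    refine squeeze_zero' (Eventually.of_forall fun _ => norm_nonneg _) ?_ hb
    filter_upwards [hxc] with N h1
    have h3 := hw _ h1
    set x := t / s N
    have e1 : w x - 1 = (w x - (1 + a * x * Complex.I)) + a * x * Complex.I := by ring
    have e2 : ‖(a : ℂ) * x * Complex.I‖ = |a| * |x| := by simp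
    rw [e1]
    refine (norm_add_le _ _).trans ?_
    rw [e2]; gcongr
  simpa using ((Complex.continuous_exp.tendsto _).comp h1).mul h2

/-- Decay of the Edgeworth characteristic function outside the central range. -/
theorem norm_edgeworth_charFun_le {v : ℝ} (hv : 0 < v) (a k : ℝ) {c : ℝ} (hc : 0 < c) :
    ∃ C : ℝ, 0 < C ∧ ∀ s t : ℝ, 1 ≤ s → 0 < t → c * s ≤ t →
      ‖Complex.exp (-(v * t ^ 2 / 2)) *
        (1 + (1 / s : ℝ) * (a * t * Complex.I + k * t ^ 3 * Complex.I))‖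
      ≤ t * (C / s ^ 2 * Real.exp (-(v / 8) * t ^ 2)) := by
  set Q := 1 + 2 / (v / 8) + 4 / (v / 8) ^ 2 + 6 / (v / 8) ^ 3 with hQ
  have ha := abs_nonneg a
  have hk := abs_nonneg k
  refine ⟨2 * (1 + |a| + |k|) * Q / c ^ 2, by positivity, fun s t hs ht hcs => ?_⟩
  have hs0 : 0 < s := by linarith
  have hgn : ‖Complex.exp (-(v * t ^ 2 / 2))‖ = Real.exp (-(v * t ^ 2 / 2)) := by
    rw [Complex.norm_exp]; simp [← Complex.ofReal_pow, ← Complex.ofReal_mul]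
  have h1 : ‖1 + ((1 / s : ℝ) : ℂ) * (a * t * Complex.I + k * t ^ 3 * Complex.I)‖ ≤
      1 + |a| * t + |k| * t ^ 3 := by
    have e1 : ‖(a : ℂ) * t * Complex.I‖ = |a| * t := by simp [abs_of_pos ht]
    have e2 : ‖(k : ℂ) * t ^ 3 * Complex.I‖ = |k| * t ^ 3 := by simp [abs_of_pos ht]
    have e3 : ‖((1 / s : ℝ) : ℂ)‖ ≤ 1 := by
      rw [Complex.norm_real, Real.norm_of_nonneg (by positivity)]
      exact (div_le_one hs0).2 hs
    have e4 := norm_add_le ((a : ℂ) * t * Complex.I) (k * t ^ 3 * Complex.I)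
    refine (norm_add_le _ _).trans ?_
    rw [norm_one, norm_mul]
    have : ‖((1 / s : ℝ) : ℂ)‖ * ‖(a : ℂ) * t * Complex.I + k * t ^ 3 * Complex.I‖ ≤
        1 * (|a| * t + |k| * t ^ 3) := by
      gcongr
      linarith
    linarith
  have hodd := odd_powers_le_exp (q := v / 8) (by positivity) t
  have h2 : t * (1 + |a| * t + |k| * t ^ 3) ≤ 2 * (1 + |a| + |k|) * (t + t ^ 3 + t ^ 5) := by
    have p3 := pow_pos ht 3
    have p5 := pow_pos ht 5
    have f2 : t ^ 2 ≤ t + t ^ 3 := by nlinarith [mul_nonneg ht.le (sq_nonneg (t - 1))]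
    have f4 : t ^ 4 ≤ t ^ 3 + t ^ 5 := by nlinarith [mul_nonneg p3.le (sq_nonneg (t - 1))]
    have g2 := mul_le_mul_of_nonneg_left f2 ha
    have g4 := mul_le_mul_of_nonneg_left f4 hk
    have := mul_nonneg ha p3.le
    have := mul_nonneg ha p5.le
    have := mul_nonneg ha ht.le
    have := mul_nonneg hk p3.le
    have := mul_nonneg hk p5.le
    have := mul_nonneg hk ht.le
    nlinarith
  -- Outside the central range this ratio can be inserted freely; it supplies the factor `1 / s²`.
  have h3 : 1 ≤ t ^ 2 / (c ^ 2 * s ^ 2) := by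
    rw [one_le_div (by positivity), ← mul_pow]
    exact pow_le_pow_left₀ (by positivity) hcs 2
  have hexp : Real.exp (-(v * t ^ 2 / 2)) * Real.exp (v / 8 * t ^ 2) ≤
      Real.exp (-(v / 8) * t ^ 2) := by
    rw [← Real.exp_add]
    refine Real.exp_le_exp.2 ?_
    nlinarith [mul_pos hv (pow_pos ht 2)]
  rw [norm_mul, hgn]
  calc Real.exp (-(v * t ^ 2 / 2)) *
        ‖1 + ((1 / s : ℝ) : ℂ) * (a * t * Complex.I + k * t ^ 3 * Complex.I)‖
      ≤ Real.exp (-(v * t ^ 2 / 2)) * (1 + |a| * t + |k| * t ^ 3) * 1 := by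
        rw [mul_one]; gcongr
    _ ≤ Real.exp (-(v * t ^ 2 / 2)) * (1 + |a| * t + |k| * t ^ 3) *
          (t ^ 2 / (c ^ 2 * s ^ 2)) := by gcongr
    _ = t / (c ^ 2 * s ^ 2) * Real.exp (-(v * t ^ 2 / 2)) *
          (t * (1 + |a| * t + |k| * t ^ 3)) := by ring
    _ ≤ t / (c ^ 2 * s ^ 2) * Real.exp (-(v * t ^ 2 / 2)) *
          (2 * (1 + |a| + |k|) * (Q * Real.exp (v / 8 * t ^ 2))) := by
        refine mul_le_mul_of_nonneg_left (h2.trans ?_) (by positivity)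
        gcongr
    _ = t * (2 * (1 + |a| + |k|) * Q / c ^ 2 / s ^ 2 *
          (Real.exp (-(v * t ^ 2 / 2)) * Real.exp (v / 8 * t ^ 2))) := by
        field_simp
    _ ≤ _ := by gcongr

end Main
end Edgeworth

/-! ### The limit theorem and the expansion -/

set_option maxHeartbeats 1000000 in
theorem mainTheorem3
    {Ω : Type*} [MeasurableSpace Ω] (P : Measure Ω) [IsProbabilityMeasure P]
    (X : ℕ → Ω → ℝ) (hX : ∀ n, Measurable (X n))
    {B : Type*} [NormedAddCommGroup B] [NormedSpace ℂ B] [CompleteSpace B]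
    (L : ℝ → B →L[ℂ] B) (u : B) (ℓ : B →L[ℂ] ℂ)
    (hcode : Edgeworth.CodedBy P X L u ℓ)
    (s : ℕ) (hs : 4 ≤ s) (r₁ : ℝ)
    (hA1 : Edgeworth.AssumptionA1 L s) (hA2 : Edgeworth.AssumptionA2 L)
    (hA3 : Edgeworth.AssumptionA3 L) (hA4 : Edgeworth.AssumptionA4 L r₁) :
    ∃ (A : ℝ) (v : ℝ≥0), Edgeworth.SatisfiesCLT P X A v ∧
      (0 < v → ∃ (P₁ : Polynomial ℝ) (C : ℝ), ∀ N : ℕ, 1 ≤ N → ∀ z : ℝ,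
        |P.real {ω | Edgeworth.normalizedSum X A N ω ≤ z}
            - (Edgeworth.normalCDF v z
              + P₁.eval z / (N : ℝ) ^ (1 / 2 : ℝ) * Edgeworth.normalDensity v z)|
          ≤ C / (N : ℝ) ^ min (1 : ℝ) (1 / 2 + r₁)) := by
  open Edgeworth in
  obtain ⟨hLc, δ, hδ, hLs⟩ := hA1
  have hL4 : ContDiffAt ℝ (4 : ℕ) L 0 :=
    (hLs.contDiffAt (Icc_mem_nhds (by linarith) hδ)).of_le (by exact_mod_cast hs)
  obtain ⟨lam, w, r, C₁, θ, c₁, hlam, hw, hlam0, hC₁, hθ, hθ1, hc₁, hexp⟩ :=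
    exists_leading_expansion (by norm_num) hL4 hA2 u ℓ
  set φ : ℕ → ℝ → ℂ := fun N t =>
    ∫ ω, Complex.exp (Complex.I * (t : ℂ) * (partialSum X N ω : ℂ)) ∂P with hφ
  have hnorm : ∀ N (t : ℝ) ω, ‖Complex.exp (Complex.I * (t : ℂ) * (partialSum X N ω : ℂ))‖ = 1 := by
    intro N t ω
    rw [mul_assoc, mul_comm, ← Complex.ofReal_mul, Complex.norm_exp_ofReal_mul_I]
  obtain ⟨A, a, k, v, ψ, C', c', hC', hc', hcum⟩ := exists_cumulant_expansion (φ := φ)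
    (fun N => by simp [hφ])
    (fun N t => by
      refine (norm_integral_le_integral_norm _).trans ?_
      simp [hnorm])
    (fun N t => by
      simp only [hφ]
      rw [← integral_conj]
      refine integral_congr_ae (Eventually.of_forall fun ω => ?_)
      simp [← Complex.exp_conj])
    (by exact_mod_cast hlam) (by exact_mod_cast hw) hlam0 hC₁ hθ hθ1 hc₁
    (fun t ht N hN => by
      obtain ⟨h1, h2⟩ := hexp t ht N hN
      exact ⟨(hcode N t hN).trans h1, h2⟩)
  have hψ := fun t ht => (hcum t ht).1
  have hw' := fun t ht => (hcum t ht).2.1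
  have hμ : ∀ N, IsProbabilityMeasure (P.map (normalizedSum X A N)) := fun N =>
    Measure.isProbabilityMeasure_map (measurable_normalizedSum hX A N).aemeasurable
  -- Centring multiplies by a unimodular factor that cancels the drift `A`, leaving only `ψ` in the
  -- exponent.
  have hcf : ∀ N : ℕ, 1 ≤ N → ∀ t : ℝ, |t / √(N : ℝ)| ≤ c' →
      ‖charFun (P.map (normalizedSum X A N)) t - Complex.exp ((√(N : ℝ) : ℂ) ^ 2 *
        ψ (t / √(N : ℝ))) * w (t / √(N : ℝ))‖ ≤ C' * N * θ ^ N * |t / √(N : ℝ)| := by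
    intro N hN t ht
    have h1 := (hcum _ ht).2.2 N hN
    set x := t / √(N : ℝ)
    have h2 : charFun (P.map (normalizedSum X A N)) t - Complex.exp ((√(N : ℝ) : ℂ) ^ 2 * ψ x) * w x
        = Complex.exp (-(N * (A * x * Complex.I))) *
          (φ N x - Complex.exp (N * (A * x * Complex.I + ψ x)) * w x) := by
      have e1 : ((√(N : ℝ) : ℝ) : ℂ) ^ 2 = N := by
        rw [← Complex.ofReal_pow, Real.sq_sqrt N.cast_nonneg]; simp
      have e2 : Complex.exp (-(N * (A * x * Complex.I))) *
          Complex.exp (N * (A * x * Complex.I + ψ x)) =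
          Complex.exp ((√(N : ℝ) : ℂ) ^ 2 * ψ x) := by
        rw [e1, ← Complex.exp_add]; congr 1; ring
      have e3 : charFun (P.map (normalizedSum X A N)) t =
          Complex.exp (-(N * (A * x * Complex.I))) * φ N x := charFun_normalizedSum hX A hN t
      rw [e3, ← e2]
      ring
    rw [h2, norm_mul]
    have h3 : ‖Complex.exp (-(N * (A * x * Complex.I)))‖ = 1 := by
      rw [show -((N : ℂ) * (A * x * Complex.I)) = ((-(N * (A * x)) : ℝ) : ℂ) * Complex.I by
        push_cast; ring, Complex.norm_exp_ofReal_mul_I]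
    rw [h3, one_mul]
    exact h1
  have hsqrt : Tendsto (fun N : ℕ => √(N : ℝ)) atTop atTop :=
    Real.tendsto_sqrt_atTop.comp tendsto_natCast_atTop_atTop
  refine ⟨A, v, ⟨fun N => (measurable_normalizedSum hX A N).aemeasurable, by fun_prop, ?_⟩, ?_⟩
  · refine ProbabilityMeasure.tendsto_iff_tendsto_charFun.2 fun t => ?_
    change Tendsto (fun N => charFun (P.map (normalizedSum X A N)) t) atTop
      (𝓝 (charFun ((gaussianReal 0 v).map id) t))
    rw [Measure.map_id, charFun_gaussianReal]
    have h1 := tendsto_exp_mul_of_cumulant hc' hψ hw' hsqrt t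
    rw [show (t * (0 : ℝ) * Complex.I - v * t ^ 2 / 2 : ℂ) = -((v : ℝ) * t ^ 2 / 2) by
      push_cast; ring]
    have h2 : Tendsto (fun N : ℕ => charFun (P.map (normalizedSum X A N)) t -
        Complex.exp ((√(N : ℝ) : ℂ) ^ 2 * ψ (t / √(N : ℝ))) * w (t / √(N : ℝ))) atTop (𝓝 0) := by
      have hx : Tendsto (fun N : ℕ => |t / √(N : ℝ)|) atTop (𝓝 0) := by
        simpa using (hsqrt.const_div_atTop t).abs
      have hb : Tendsto (fun N : ℕ => C' * ((N : ℝ) ^ 1 * θ ^ N) * |t / √(N : ℝ)|) atTop (𝓝 0) := by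
        simpa using ((tendsto_pow_const_mul_const_pow_of_lt_one 1 hθ.le hθ1).const_mul C').mul hx
      refine squeeze_zero_norm' ?_ hb
      filter_upwards [hx.eventually_le_const hc', eventually_ge_atTop 1] with N h1 h2
      refine (hcf N h2 t h1).trans (le_of_eq ?_)
      ring
    simpa using h2.add h1
  intro hv
  have hv' : (0 : ℝ) < v := by exact_mod_cast hv
  obtain ⟨P₁, g, M, hg⟩ := exists_edgeworth_density hv a k
  obtain ⟨C₂, c, hC₂, hc, hcc', hc1, hcentral⟩ := exists_central_estimate hv' hC' hc' hψ hw'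
  obtain ⟨C₃, c₂, hC₃, hc₂, hc₂1, N₁, hhigh⟩ := exists_high_frequency_bound hLc hA3 hA4 hc
  obtain ⟨C₄, hC₄, htail⟩ := norm_edgeworth_charFun_le hv' a k hc
  -- Exponent three turns the remainder factor `N * θ ^ N` into `C₅ / N²`.
  obtain ⟨C₅, hC₅, hgeo⟩ := exists_natCast_pow_mul_pow_le hθ.le hθ1 3
  obtain ⟨C₀, hC₀, hess⟩ := exists_esseen_constant
  have hr₁ : 0 < r₁ := hA4.1
  set ρ := min (1 : ℝ) (1 / 2 + r₁) with hρ
  have hρ1 : ρ ≤ 1 := min_le_left _ _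
  have hρ2 : ρ ≤ 1 / 2 + r₁ := min_le_right _ _
  have hM0 : 0 ≤ M := (abs_nonneg _).trans ((hg 0 (by simp)).2.1 0)
  set J := ∫ t : ℝ, Real.exp (-(v / 8) * t ^ 2) with hJ
  have hJi : Integrable fun t : ℝ => Real.exp (-((v : ℝ) / 8) * t ^ 2) :=
    integrable_exp_neg_mul_sq (by positivity)
  have hJ0 : 0 ≤ J := integral_nonneg fun _ => (Real.exp_pos _).le
  set D := C' * C₅ + ‖ℓ‖ * ‖u‖ * C₃ / c with hD
  have hD0 : 0 ≤ D := by positivity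
  set C₆ := C₀ * ((C₂ + C₄) * J + D + M / c₂) with hC₆
  have hC₆0 : 0 ≤ C₆ := by positivity
  have hlarge : ∀ N : ℕ, 1 ≤ N → N₁ ≤ N → ∀ z : ℝ,
      |P.real {ω | normalizedSum X A N ω ≤ z} - (normalCDF v z
        + P₁.eval z * (1 / √(N : ℝ)) * normalDensity v z)| ≤ C₆ / (N : ℝ) ^ ρ := by
    intro N hN hN1 z
    have hN' : (1 : ℝ) ≤ N := by exact_mod_cast hN
    have hNpos : (0 : ℝ) < N := by linarith
    set σ := √(N : ℝ) with hσ
    have hσ1 : 1 ≤ σ := Real.one_le_sqrt.2 hN'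
    have hσ0 : 0 < σ := by linarith
    have hσ2 : σ ^ 2 = N := Real.sq_sqrt hNpos.le
    have hσi : |1 / σ| ≤ 1 := by
      rw [abs_of_pos (by positivity)]; exact (div_le_one hσ0).2 hσ1
    obtain ⟨hgi, hgM, hgG, -, hgF⟩ := hg (1 / σ) hσi
    -- From `ρ ≤ 1/2 + r₁`, `t ≤ T` keeps `t / √N` within the high-frequency bound; from `ρ ≤ 1`, `T
    -- ≤ N`, so the constant term `D / N²` integrates to at most `D / N`.
    set T := c₂ * (N : ℝ) ^ ρ with hT
    have hNρ : 0 < (N : ℝ) ^ ρ := by positivity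
    have hNρN : (N : ℝ) ^ ρ ≤ N := by
      calc (N : ℝ) ^ ρ ≤ (N : ℝ) ^ (1 : ℝ) := Real.rpow_le_rpow_of_exponent_le hN' hρ1
        _ = N := Real.rpow_one _
    have hT0 : 0 < T := by positivity
    have hTN : T ≤ N := by
      calc T ≤ 1 * (N : ℝ) ^ ρ := mul_le_mul_of_nonneg_right hc₂1 hNρ.le
        _ ≤ N := by rwa [one_mul]
    let b : ℝ → ℝ := fun t => (C₂ + C₄) / N * Real.exp (-(v / 8) * t ^ 2) + D / (N : ℝ) ^ 2
    have hbc : Continuous b := by fun_prop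
    have hpt : ∀ t, 0 < t → t ≤ T → ‖charFun (P.map (normalizedSum X A N)) t -
        ∫ x : ℝ, Complex.exp (t * x * Complex.I) * g (1 / σ) x‖ ≤ t * b t := by
      intro t ht htT
      rw [hgF]
      have hE := Real.exp_pos (-((v : ℝ) / 8) * t ^ 2)
      set E := Real.exp (-((v : ℝ) / 8) * t ^ 2)
      have hx0 : 0 < t / σ := by positivity
      rcases le_total t (c * σ) with htc | htc
      · have hxc : t / σ ≤ c := (div_le_iff₀ hσ0).2 htc
        have h1 := hcf N hN t (by rw [abs_of_pos hx0]; exact hxc.trans hcc')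
        have h2 := hcentral σ t hσ0 ht htc
        rw [abs_of_pos hx0] at h1
        have h3 : C' * N * θ ^ N * (t / σ) ≤ t * (C' * C₅ / (N : ℝ) ^ 2) := by
          have e1 : t / σ ≤ t := div_le_self ht.le hσ1
          have e2 : (N : ℝ) * θ ^ N ≤ C₅ / (N : ℝ) ^ 2 := by
            rw [le_div_iff₀ (by positivity)]
            calc (N : ℝ) * θ ^ N * (N : ℝ) ^ 2 = (N : ℝ) ^ 3 * θ ^ N := by ring
              _ ≤ C₅ := hgeo N
          calc C' * N * θ ^ N * (t / σ) = C' * (N * θ ^ N) * (t / σ) := by ring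
            _ ≤ C' * (C₅ / (N : ℝ) ^ 2) * t := by gcongr
            _ = _ := by ring
        have h4 : C' * C₅ / (N : ℝ) ^ 2 ≤ D / (N : ℝ) ^ 2 := by
          gcongr
          have : 0 ≤ ‖ℓ‖ * ‖u‖ * C₃ / c := by positivity
          linarith
        have h5 : C₂ / N * E ≤ (C₂ + C₄) / N * E := by
          gcongr; linarith
        rw [hσ2] at h2
        refine (norm_sub_le_norm_sub_add_norm_sub _ _ _).trans ((add_le_add (h1.trans h3) h2).trans ?_)
        rw [← mul_add]
        refine mul_le_mul_of_nonneg_left ?_ ht.le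
        change C' * C₅ / (N : ℝ) ^ 2 + C₂ / N * E ≤ (C₂ + C₄) / N * E + D / (N : ℝ) ^ 2
        linarith
      · have hxc : c ≤ t / σ := (le_div_iff₀ hσ0).2 htc
        have hx2 : t / σ ≤ c₂ * (N : ℝ) ^ r₁ := by
          rw [div_le_iff₀ hσ0]
          refine htT.trans ?_
          rw [hT, mul_assoc, hσ, Real.sqrt_eq_rpow, ← Real.rpow_add hNpos]
          gcongr
          linarith
        have h1 := hhigh N hN1 (t / σ) (by rwa [abs_of_pos hx0]) (by rwa [abs_of_pos hx0])
        have h2 := htail σ t hσ1 ht htc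
        rw [hσ2] at h2
        -- Here `t` is bounded below, so the factor `t` can be inserted at the cost of `1 / c`.
        have htc' : c ≤ t := le_trans (by nlinarith) htc
        have h3 : ‖charFun (P.map (normalizedSum X A N)) t‖ ≤ t * (D / (N : ℝ) ^ 2) := by
          rw [charFun_normalizedSum hX A hN, norm_mul, hcode N _ hN]
          have e1 : ‖Complex.exp (-(N * (A * (t / √(N : ℝ) : ℝ) * Complex.I)))‖ = 1 := by
            rw [show -((N : ℂ) * (A * (t / √(N : ℝ) : ℝ) * Complex.I)) =
              ((-(N * (A * (t / √(N : ℝ)))) : ℝ) : ℂ) * Complex.I by push_cast; ring,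
              Complex.norm_exp_ofReal_mul_I]
          rw [e1, one_mul]
          calc ‖ℓ ((L (t / √(N : ℝ)) ^ N) u)‖
              ≤ ‖ℓ‖ * (‖L (t / σ) ^ N‖ * ‖u‖) :=
                (ℓ.le_opNorm _).trans (by gcongr; exact ContinuousLinearMap.le_opNorm _ _)
            _ ≤ ‖ℓ‖ * (C₃ / (N : ℝ) ^ 2 * ‖u‖) := by gcongr
            _ = c * (‖ℓ‖ * ‖u‖ * C₃ / c / (N : ℝ) ^ 2) := by field_simp
            _ ≤ t * (D / (N : ℝ) ^ 2) := by
                gcongr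
                have : 0 ≤ C' * C₅ := by positivity
                linarith
        have h5 : C₄ / N * E ≤ (C₂ + C₄) / N * E := by
          gcongr; linarith
        refine (norm_sub_le _ _).trans ((add_le_add h3 h2).trans ?_)
        rw [← mul_add]
        refine mul_le_mul_of_nonneg_left ?_ ht.le
        change D / (N : ℝ) ^ 2 + C₄ / N * E ≤ (C₂ + C₄) / N * E + D / (N : ℝ) ^ 2
        linarith
    have hE := hess (P.map (normalizedSum X A N)) (g (1 / σ)) M T b hgi hgM hT0
      (hbc.intervalIntegrable _ _) hpt z
    rw [hgG, map_measureReal_apply (measurable_normalizedSum hX A N) measurableSet_Iic] at hE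
    refine hE.trans ?_
    have hint : ∫ t in (0 : ℝ)..T, b t ≤ ((C₂ + C₄) * J + D) / (N : ℝ) ^ ρ := by
      simp only [b]
      rw [intervalIntegral.integral_add (Continuous.intervalIntegrable (by fun_prop) _ _)
        (by simp), intervalIntegral.integral_const_mul, intervalIntegral.integral_const, sub_zero,
        smul_eq_mul, add_div ((C₂ + C₄) * J) D]
      refine add_le_add ?_ ?_
      · have h1 : ∫ t in (0 : ℝ)..T, Real.exp (-((v : ℝ) / 8) * t ^ 2) ≤ J := by
          rw [intervalIntegral.integral_of_le hT0.le]
          exact setIntegral_le_integral hJi (Eventually.of_forall fun _ => (Real.exp_pos _).le)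
        calc _ ≤ (C₂ + C₄) / N * J := by gcongr
          _ = (C₂ + C₄) * J / N := by ring
          _ ≤ _ := by gcongr
      · calc T * (D / (N : ℝ) ^ 2) ≤ N * (D / (N : ℝ) ^ 2) := by gcongr
          _ = D / N := by field_simp
          _ ≤ _ := by gcongr
    have hMT : M / T = M / c₂ / (N : ℝ) ^ ρ := by rw [hT]; field_simp
    calc C₀ * ((∫ t in (0 : ℝ)..T, b t) + M / T)
        ≤ C₀ * (((C₂ + C₄) * J + D) / (N : ℝ) ^ ρ + M / c₂ / (N : ℝ) ^ ρ) := by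
          rw [hMT]; gcongr
      _ = C₆ / (N : ℝ) ^ ρ := by rw [hC₆]; ring
  -- For `N < N₁` the difference is at most `1 + M` and `N ^ ρ ≤ N₁`, which explains the second
  -- summand.
  refine ⟨P₁, C₆ + (1 + M) * N₁, fun N hN z => ?_⟩
  have hN' : (1 : ℝ) ≤ N := by exact_mod_cast hN
  have hNρ : 0 < (N : ℝ) ^ ρ := by positivity
  have hrw : P₁.eval z / (N : ℝ) ^ (1 / 2 : ℝ) * normalDensity v z =
      P₁.eval z * (1 / √(N : ℝ)) * normalDensity v z := by
    rw [Real.sqrt_eq_rpow]; ring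
  rw [hrw]
  by_cases hNN : N₁ ≤ N
  · refine (hlarge N hN hNN z).trans ?_
    gcongr
    have : 0 ≤ (1 + M) * (N₁ : ℝ) := by positivity
    linarith
  · have hNN' : (N : ℝ) ≤ N₁ := by exact_mod_cast (not_le.1 hNN).le
    have hσ1 : 1 ≤ √(N : ℝ) := Real.one_le_sqrt.2 hN'
    have hG := (hg (1 / √(N : ℝ)) (by
      rw [abs_of_pos (by positivity)]; exact (div_le_one (by positivity)).2 hσ1)).2.2.2.1 z
    have hP : |P.real {ω | normalizedSum X A N ω ≤ z}| ≤ 1 := by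
      rw [abs_of_nonneg measureReal_nonneg]; exact measureReal_le_one
    have hNρN : (N : ℝ) ^ ρ ≤ N₁ := by
      calc (N : ℝ) ^ ρ ≤ (N : ℝ) ^ (1 : ℝ) := Real.rpow_le_rpow_of_exponent_le hN' hρ1
        _ = N := Real.rpow_one _
        _ ≤ N₁ := hNN'
    rw [le_div_iff₀ hNρ]
    refine (mul_le_mul ((abs_sub _ _).trans (add_le_add hP hG)) hNρN hNρ.le (by positivity)).trans ?_
    linarith
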